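/- Let $X_1,\dots,X_n$ be $n$ independent copies of a random vector $X\in\mathbb R^d$ with $\mathbb E\|X\|^2<\infty$, and put $N(\theta)=\mathbb E\langle\theta,X\rangle^2$, $\theta\in\mathbb R^d$. Let $\psi:\mathbb R\to\mathbb R$ be the odd function with $\psi(x)=-\log(1-x+x^2/2)$ for $0\le x\le 1$ and $\psi(x)=\log 2$ for $x\ge 1$. For $\lambda>0$ let $$r_\lambda(\theta)=\frac1{n\lambda}\sum_{i=1}^n\psi\bigl(\lambda(\langle\theta,X_i\rangle^2-1)\bigr),\qquad \widehat\alpha(\theta)=\sup\{\alpha\ge 0:\ r_\lambda(\alpha\theta)\le 0\}\in[0,\infty],\qquad \widehat N_\lambda(\theta)=\widehat\alpha(\theta)^{-2}.$$ Assume that, for some known constant $\kappa>1$, $$\sup\bigl\{\mathbb E\langle\theta,X\rangle^4:\ \theta\in\mathbb R^d,\ \mathbb E\langle\theta,X\rangle^2\le 1\bigr\}\le\kappa.$$ For $\epsilon>0$ put $$\lambda=\sqrt{\frac{2}{(\kappa-1)n}\bigl[\log(\epsilon^{-1})+0.73\,d\bigr]},\qquad \mu=\sqrt{\frac{2(\kappa-1)}{n}\bigl[\log(\epsilon^{-1})+0.73\,d\bigr]}+6.81\sqrt{\frac{2\kappa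 d}{n}},$$ $$T=\Bigl[20\sqrt{\kappa d}+\Bigl(\tfrac52+\tfrac1{2(\kappa-1)}\Bigr)\sqrt{2(\kappa-1)\bigl[\log(\epsilon^{-1})+0.73\,d\bigr]}\Bigr]^2 .$$ (1) If $n>T$, then each of the two statements $$\text{for all }\theta\in\mathbb R^d:\ \frac{N(\theta)}{\widehat N_\lambda(\theta)}-1\le\frac{\mu}{1-2\mu},\qquad\qquad \text{for all }\theta\in\mathbb R^d:\ \frac{N(\theta)}{\widehat N_\lambda(\theta)}-1\ge-\frac{\mu}{1-2\mu}$$ holds with probability at least $1-\epsilon$, and with probability at least $1-2\epsilon$ $$\text{for all }\theta\in\mathbb R^d:\quad\Bigl|\frac{N(\theta)}{\widehat N_\lambda(\theta)}-1\Bigr|\le\frac{\mu}{1-2\mu}.$$ Here $z/0=1$ if $z=0$ and $z/0=+\infty$ if $z>0$, and "with probability at least $p$" means that the event contains a measurable event of probability at least $p$. (For $\epsilon\ge 1$ these claims are void.) (2) There is a numerical constant $C$ such that, for all $d$, $n$, $\kappa>1$ and $\epsilon>0$ with $\log(\epsilon^{-1})+0.73\,d\ge 0$ and $n>T$, one has $\mu<1/2$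 and $$\frac{\mu}{1-2\mu}\le C\sqrt{\frac{\kappa\,[d+\log(\epsilon^{-1})]}{n}} .$$ (3) For every $\kappa_0>1$ there is a constant $C$, depending only on $\kappa_0$, such that $T\le C\,\kappa\,[d+\log(\epsilon^{-1})]$ for all $d$, all $\kappa\ge\kappa_0$ and all $\epsilon>0$ with $\log(\epsilon^{-1})+0.73\,d\ge 0$. -/

import Mathlib

open MeasureTheory ProbabilityTheory
open scoped ENNReal NNReal

noncomputable section

namespace RobustGram

/-- The influence function `ψ` on the half-line `x ≥ 0`. -/
def psiPos (x : ℝ) : ℝ :=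
  if 1 ≤ x then Real.log 2 else -Real.log (1 - x + x ^ 2 / 2)

/-- The influence function `ψ`: the odd extension of `psiPos`. -/
def psi (x : ℝ) : ℝ :=
  if 0 ≤ x then psiPos x else -psiPos (-x)

/-- The energy `N(θ) = E ⟨θ, X⟩²` of a random vector `X` with law `P`. -/
def energy {d : ℕ} (P : Measure (EuclideanSpace ℝ (Fin d)))
    (θ : EuclideanSpace ℝ (Fin d)) : ℝ :=
  ∫ x, inner ℝ θ x ^ 2 ∂P

/-- The kurtosis coefficient `sup {E ⟨θ, X⟩⁴ : E ⟨θ, X⟩² ≤ 1}`, as an element of `[0, ∞]`. -/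
def kurtosis {d : ℕ} (P : Measure (EuclideanSpace ℝ (Fin d))) : ℝ≥0∞ :=
  ⨆ (θ : EuclideanSpace ℝ (Fin d)) (_ : energy P θ ≤ 1),
    ∫⁻ x, ENNReal.ofReal (inner ℝ θ x ^ 4) ∂P

/-- The empirical criterion `r_l(θ)` of the sample `x 0, …, x (n - 1)`, with scale parameter `l`:
`l⁻¹` times the integral of `ψ (l (⟨θ, ·⟩² - 1))` against the empirical measure. -/
def criterion {d n : ℕ} (l : ℝ) (x : Fin n → EuclideanSpace ℝ (Fin d))
    (θ : EuclideanSpace ℝ (Fin d)) : ℝ :=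
  l⁻¹ * ((n : ℝ)⁻¹ * ∑ i, psi (l * (inner ℝ θ (x i) ^ 2 - 1)))

/-- The factor `α̂(θ) = sup {α ≥ 0 : r_l(α θ) ≤ 0}`, as an element of `[0, ∞]`. -/
def alphaHat {d n : ℕ} (l : ℝ) (x : Fin n → EuclideanSpace ℝ (Fin d))
    (θ : EuclideanSpace ℝ (Fin d)) : ℝ≥0∞ :=
  ⨆ (α : ℝ≥0) (_ : criterion l x ((α : ℝ) • θ) ≤ 0), (α : ℝ≥0∞)

/-- The robust estimator `N̂_l(θ) = α̂(θ)⁻²`, equal to `0` when `α̂(θ) = ∞`. -/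
def energyHat {d n : ℕ} (l : ℝ) (x : Fin n → EuclideanSpace ℝ (Fin d))
    (θ : EuclideanSpace ℝ (Fin d)) : ℝ≥0∞ :=
  (alphaHat l x θ ^ 2)⁻¹

/-- The quotient `a / b` in `[0, ∞]` with the conventions `0 / 0 = 1` and `a / 0 = ∞` for `a > 0`,
seen as an extended real number so that `1` can be subtracted from it. -/
def ratio (a b : ℝ≥0∞) : EReal :=
  if a = 0 ∧ b = 0 then 1 else ((a / b : ℝ≥0∞) : EReal)

/-- The relative error `N(θ) / N̂_l(θ) - 1`. -/
def relError {d n : ℕ} (P : Measure (EuclideanSpace ℝ (Fin d))) (l : ℝ)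
    (x : Fin n → EuclideanSpace ℝ (Fin d)) (θ : EuclideanSpace ℝ (Fin d)) : EReal :=
  ratio (ENNReal.ofReal (energy P θ)) (energyHat l x θ) - 1

/-- The quantity `log (ε⁻¹) + 0.73 d`. -/
def complexity (d : ℕ) (ε : ℝ) : ℝ :=
  Real.log ε⁻¹ + 0.73 * d

/-- The scale parameter `λ`. -/
def scale (d n : ℕ) (κ ε : ℝ) : ℝ :=
  √(2 / ((κ - 1) * n) * complexity d ε)

/-- The quantity `μ`. -/
def mu (d n : ℕ) (κ ε : ℝ) : ℝ :=
  √(2 * (κ - 1) / n * complexity d ε) + 6.81 * √(2 * κ * d / n)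

/-- The lower bound imposed on the sample size. -/
def threshold (d : ℕ) (κ ε : ℝ) : ℝ :=
  (20 * √(κ * d) + (5 / 2 + 1 / (2 * (κ - 1))) * √(2 * (κ - 1) * complexity d ε)) ^ 2

/-- The event `A` (not necessarily measurable) has probability at least `p`: it contains
a measurable event of probability at least `p`. -/
def ProbAtLeast {Ω : Type*} [MeasurableSpace Ω] (Pr : Measure Ω) (p : ℝ) (A : Set Ω) : Prop :=
  ∃ B : Set Ω, MeasurableSet B ∧ B ⊆ A ∧ ENNReal.ofReal p ≤ Pr B

end RobustGram

end

/-!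
By homogeneity it suffices to treat directions `θ` of energy one. For these, `N(θ) / N̂(θ)` is the
square of `α̂(θ)`, and as the criterion `r (α θ)` is nondecreasing in `α ≥ 0`, both bounds follow once
`r (√(1 + δ) θ) > 0` and `r (√(1 - δ) θ) ≤ 0` are known for all such `θ`, where `δ = μ / (1 - 2 μ)`.
Directions of zero energy are orthogonal to the sample almost surely, all at once.

The deviations of `r` are controlled uniformly in `θ` by a PAC-Bayes argument
(`exists_event_pac_bayes`): `θ` is replaced by a Gaussian perturbation `θ'` in coordinates in which
the Gram matrix is the identity on the range of `X` (`exists_whitening`). The price is the relative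
entropy, a multiple of the energy of `θ` that does not involve `d`, computed through the Cameron–Martin formula.
The quantity `ψ (± λ (⟨θ, x⟩² - 1))` has to be bounded by the mean over `θ'` of a function of
`⟨θ', x⟩` whose exponential has the right mean over `x`. This is the role of `surrogate`. The function
`log (1 + z + z² / 2)` dominates `ψ` and has second derivative at least `-1/4`, so moving `ψ` inside
the mean loses at most a multiple of the variance of the perturbed argument
(`exists_parabola_le`). The loss, capped since `ψ` is bounded, is compensated by a second term
(`psi_le_integral_surrogate`), and the exponential of the sum is at most a polynomial of degree
four in `⟨θ', x⟩` (`exp_surrogate_le`), whose mean is controlled by the kurtosis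
(`integral_expansion_le`). Optimizing the variance of the perturbation gives a bound
slightly better than the one required (`exists_event_drift`). The remaining inequalities
between `δ`, `μ`, `λ` and the sample size are elementary (`drift_upper_nonpos`,
`drift_lower_nonpos`).
-/

namespace RobustGram

/-! ### The influence function -/

lemma quad_pos (x : ℝ) : 0 < 1 + x + x ^ 2 / 2 := by nlinarith [sq_nonneg (x + 1)]

lemma half_le_quad (x : ℝ) : 1 / 2 ≤ 1 + x + x ^ 2 / 2 := by nlinarith [sq_nonneg (x + 1)]

lemma hasDerivAt_log_quad (x : ℝ) :
    HasDerivAt (fun z : ℝ => Real.log (1 + z + z ^ 2 / 2)) ((1 + x) / (1 + x + x ^ 2 / 2)) x := by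
  have h : HasDerivAt (fun z : ℝ => 1 + z + z ^ 2 / 2) (1 + x) x := by
    have h1 : HasDerivAt (fun z : ℝ => 1 + z) 1 x := (hasDerivAt_id' x).const_add 1
    have h2 : HasDerivAt (fun z : ℝ => z ^ 2 / 2) x x := by
      refine ((hasDerivAt_pow 2 x).div_const 2).congr_deriv ?_
      push_cast
      ring
    exact h1.add h2
  exact h.log (quad_pos x).ne'

lemma hasDerivAt_log_quad_add (x : ℝ) :
    HasDerivAt (fun z : ℝ => Real.log (1 + z + z ^ 2 / 2) + z ^ 2 / 8)
      ((1 + x) / (1 + x + x ^ 2 / 2) + x / 4) x := by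
  have h : HasDerivAt (fun z : ℝ => z ^ 2 / 8) (x / 4) x := by
    refine ((hasDerivAt_pow 2 x).div_const 8).congr_deriv ?_
    push_cast
    ring
  exact (hasDerivAt_log_quad x).add h

/-- The second derivative of `z ↦ log (1 + z + z² / 2)` is at least `-1/4`. -/
lemma convexOn_log_quad_add :
    ConvexOn ℝ Set.univ (fun z : ℝ => Real.log (1 + z + z ^ 2 / 2) + z ^ 2 / 8) := by
  have hd := hasDerivAt_log_quad_add
  refine MonotoneOn.convexOn_of_deriv convex_univ
    (fun x _ => (hd x).continuousAt.continuousWithinAt)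
    (fun x _ => (hd x).differentiableAt.differentiableWithinAt) ?_
  intro x _ y _ hxy
  rw [(hd x).deriv, (hd y).deriv]
  have hx := quad_pos x
  have hy := quad_pos y
  have key : ((1 + y) / (1 + y + y ^ 2 / 2) + y / 4) - ((1 + x) / (1 + x + x ^ 2 / 2) + x / 4)
      = (y - x) * (2 * (1 - (1 + x) * (1 + y)) + (1 + x + x ^ 2 / 2) * (1 + y + y ^ 2 / 2))
        / (4 * ((1 + x + x ^ 2 / 2) * (1 + y + y ^ 2 / 2))) := by
    rw [eq_div_iff (by positivity), div_add_div _ _ hy.ne' (by norm_num),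
      div_add_div _ _ hx.ne' (by norm_num), div_sub_div _ _ (by positivity) (by positivity),
      div_mul_eq_mul_div, div_eq_iff (by positivity)]
    ring
  have hn : 0 ≤ 2 * (1 - (1 + x) * (1 + y)) + (1 + x + x ^ 2 / 2) * (1 + y + y ^ 2 / 2) := by
    nlinarith [sq_nonneg ((1 + x) * (1 + y) - 3), sq_nonneg (x - y)]
  have : 0 ≤ ((1 + y) / (1 + y + y ^ 2 / 2) + y / 4) - ((1 + x) / (1 + x + x ^ 2 / 2) + x / 4) := by
    rw [key]
    exact div_nonneg (mul_nonneg (by linarith) hn) (by positivity)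
  linarith

/-- Since `log (1 + z + z² / 2)` is convex up to `z² / 8`, it lies above each of its tangents
lowered by the corresponding parabola. -/
lemma tangent_le_log_quad (x y : ℝ) :
    Real.log (1 + x + x ^ 2 / 2) + (1 + x) / (1 + x + x ^ 2 / 2) * (y - x) - (y - x) ^ 2 / 8 ≤
      Real.log (1 + y + y ^ 2 / 2) := by
  have hd := hasDerivAt_log_quad_add x
  rcases lt_trichotomy x y with h | h | h
  · have := convexOn_log_quad_add.le_slope_of_hasDerivAt (Set.mem_univ x) (Set.mem_univ y) h hd
    rw [slope_def_field, le_div_iff₀ (by linarith)] at this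
    nlinarith
  · subst h; simp
  · have := convexOn_log_quad_add.slope_le_of_hasDerivAt (Set.mem_univ y) (Set.mem_univ x) h hd
    rw [slope_def_field, div_le_iff₀ (by linarith)] at this
    nlinarith

lemma psi_zero : psi 0 = 0 := by simp [psi, psiPos]

lemma psi_neg (x : ℝ) : psi (-x) = -psi x := by
  rcases lt_trichotomy x 0 with h | h | h
  · rw [psi, psi, if_pos (by linarith), if_neg (by linarith), neg_neg]
  · subst h; simp [psi_zero]
  · rw [psi, psi, if_neg (by linarith), if_pos h.le, neg_neg]

lemma psiPos_mono {x y : ℝ} (hxy : x ≤ y) : psiPos x ≤ psiPos y := by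
  unfold psiPos
  split_ifs with h1 h2 h2
  · exact le_rfl
  · linarith
  · rw [← Real.log_inv]
    have h0 : 0 < 1 - x + x ^ 2 / 2 := by nlinarith [sq_nonneg (x - 1)]
    refine Real.log_le_log (by positivity) ?_
    rw [inv_le_comm₀ h0 (by norm_num)]
    nlinarith [sq_nonneg (x - 1)]
  · refine neg_le_neg (Real.log_le_log (by nlinarith [sq_nonneg (y - 1)]) ?_)
    nlinarith

lemma psiPos_nonneg {x : ℝ} (hx : 0 ≤ x) : 0 ≤ psiPos x := by
  have : psiPos 0 = 0 := by simp [psiPos]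
  exact this ▸ psiPos_mono hx

lemma psi_mono : Monotone psi := by
  intro x y hxy
  unfold psi
  split_ifs with h1 h2 h2
  · exact psiPos_mono hxy
  · linarith
  · linarith [psiPos_nonneg h2, psiPos_nonneg (x := -x) (by linarith)]
  · exact neg_le_neg (psiPos_mono (by linarith))

lemma psi_le_log_two (x : ℝ) : psi x ≤ Real.log 2 := by
  have h : psi (max x 1) = Real.log 2 := by
    rw [psi, if_pos (by positivity), psiPos, if_pos (le_max_right _ _)]
  exact h ▸ psi_mono (le_max_left _ _)

lemma psi_nonpos {x : ℝ} (hx : x ≤ 0) : psi x ≤ 0 := psi_zero ▸ psi_mono hx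

/-- Applied to `x` and to `-x`, this is the sandwich
`-log (1 - x + x² / 2) ≤ ψ x ≤ log (1 + x + x² / 2)`. -/
lemma psi_le_log_quad (x : ℝ) : psi x ≤ Real.log (1 + x + x ^ 2 / 2) := by
  have hq := quad_pos x
  unfold psi psiPos
  split_ifs with h0 h1 h1
  · exact Real.log_le_log (by norm_num) (by nlinarith)
  · rw [← Real.log_inv]
    have hx : 0 < 1 - x + x ^ 2 / 2 := by nlinarith [sq_nonneg (x - 1)]
    refine Real.log_le_log (by positivity) ?_
    rw [inv_le_iff_one_le_mul₀ hx]
    nlinarith [sq_nonneg (x ^ 2)]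
  · rw [← Real.log_inv]
    refine Real.log_le_log (by positivity) ?_
    linarith [half_le_quad x]
  · rw [neg_neg]
    exact Real.log_le_log (by nlinarith [sq_nonneg (x + 1)]) (by nlinarith)

lemma log_five_gt : 1.608 < Real.log 5 := by
  have h5 : Real.log 5 = 2 * Real.log 2 + Real.log (1 + 1 / 4) := by
    rw [two_mul, ← Real.log_mul (by norm_num) (by norm_num),
      ← Real.log_mul (by norm_num) (by norm_num)]
    norm_num
  have := Real.le_log_one_add_of_nonneg (x := 1 / 4) (by norm_num)
  have := Real.log_two_gt_d9
  norm_num at *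
  linarith

/-- The left-hand side is the maximum of the parabola `y ↦ ψ x + p (y - x) - (y - x)² / 5`, where
`p` is the slope of `log (1 + z + z² / 2)` at `x`.
This maximum is at most about `1.57`, and `log 5 ≈ 1.609`. -/
lemma psi_add_slope_sq_le (x : ℝ) :
    psi x + 5 / 4 * ((1 + x) / (1 + x + x ^ 2 / 2)) ^ 2 ≤ Real.log 5 := by
  have hq := quad_pos x
  have h5 := log_five_gt
  have hl2 := Real.log_two_gt_d9
  have hl2' := Real.log_two_lt_d9
  set D := 1 + x + x ^ 2 / 2 with hD
  rcases le_or_gt x 0 with hx | hx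
  · have h1 : ((1 + x) / D) ^ 2 ≤ 1 := by
      rw [div_pow, div_le_one (by positivity)]
      nlinarith [sq_nonneg (D - 1)]
    linarith [psi_nonpos hx]
  rcases le_or_gt 1 x with h1 | h1
  · have h2 : ((1 + x) / D) ^ 2 ≤ 0.64 := by
      rw [div_pow, div_le_iff₀ (by positivity)]
      have hD2 : 5 / 2 ≤ D := by nlinarith
      have : (1 + x) ^ 2 = 2 * D - 1 := by rw [hD]; ring
      nlinarith
    linarith [psi_le_log_two x]
  · have hpsi : psi x = -Real.log (1 - x + x ^ 2 / 2) := by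
      rw [psi, if_pos hx.le, psiPos, if_neg (by linarith)]
    set v := 1 - x + x ^ 2 / 2 with hv
    have hv2 : 1 / 2 ≤ v := by nlinarith [sq_nonneg (x - 1)]
    have hlog : Real.log v = Real.log (1 + (2 * v - 1)) - Real.log 2 := by
      rw [show 1 + (2 * v - 1) = 2 * v by ring, Real.log_mul (by norm_num) (by linarith)]; ring
    have hp := Real.le_log_one_add_of_nonneg (x := 2 * v - 1) (by linarith)
    have h2 : 5 / 4 * ((1 + x) / D) ^ 2 ≤ 0.914 + 2 * (2 * v - 1) / (2 * v - 1 + 2) := by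
      have hpos : 0 < 2 * v - 1 + 2 := by linarith
      rw [div_pow, ← mul_div_assoc, div_le_iff₀ (by positivity), ← sub_nonneg]
      have e1 : 2 * v - 1 + 2 = 3 - 2 * x + x ^ 2 := by rw [hv]; ring
      have e2 : 2 * v - 1 = (1 - x) ^ 2 := by rw [hv]; ring
      rw [e1] at hpos ⊢
      rw [e2, hD]
      have hb (i j : ℕ) : 0 ≤ x ^ i * (1 - x) ^ j :=
        mul_nonneg (pow_nonneg hx.le _) (pow_nonneg (by linarith) _)
      have key : (0.914 + 2 * (1 - x) ^ 2 / (3 - 2 * x + x ^ 2)) * (1 + x + x ^ 2 / 2) ^ 2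
          - 5 / 4 * (1 + x) ^ 2 =
          ((0.914 * (3 - 2 * x + x ^ 2) + 2 * (1 - x) ^ 2) * (1 + x + x ^ 2 / 2) ^ 2
            - 5 / 4 * (1 + x) ^ 2 * (3 - 2 * x + x ^ 2)) / (3 - 2 * x + x ^ 2) := by
        field_simp
      rw [key]
      refine div_nonneg ?_ hpos.le
      -- all coefficients of this polynomial in the Bernstein basis of degree six are positive
      linarith [hb 0 6, hb 1 5, hb 2 4, hb 3 3, hb 4 2, hb 5 1, hb 6 0]
    rw [hpsi, hlog]
    linarith

/-- Through each point of the graph of `ψ` passes a parabola of second derivative `-2/5` that stays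
below the truncated function `min (log (1 + y + y² / 2)) (log 5)`. Integrated against a law of
mean `x`, this is a reversed Jensen inequality with an explicit variance loss. -/
lemma exists_parabola_le (x : ℝ) : ∃ p : ℝ, ∀ y : ℝ,
    psi x + p * (y - x) - (y - x) ^ 2 / 5 ≤ min (Real.log (1 + y + y ^ 2 / 2)) (Real.log 5) := by
  refine ⟨(1 + x) / (1 + x + x ^ 2 / 2), fun y => le_min ?_ ?_⟩
  · nlinarith [tangent_le_log_quad x y, psi_le_log_quad x, sq_nonneg (y - x)]
  · have := psi_add_slope_sq_le x
    nlinarith [sq_nonneg (5 / 2 * ((1 + x) / (1 + x + x ^ 2 / 2)) - (y - x))]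

/-- The convex function `exp (2 m)` lies below its chord on `[0, log 4]`, of slope
`15 / log 4 < 11`. -/
lemma exp_two_mul_min_le {u : ℝ} (hu : 0 ≤ u) :
    Real.exp (2 * min (Real.log 4) u) ≤ 1 + 11 * u := by
  have hl4 : Real.log 4 = 2 * Real.log 2 := by
    rw [two_mul, ← Real.log_mul (by norm_num) (by norm_num)]; norm_num
  have hl2 := Real.log_two_gt_d9
  have h4 : 15 ≤ 11 * Real.log 4 := by linarith
  set m := min (Real.log 4) u with hm
  have hm0 : 0 ≤ m := le_min (by linarith) hu
  have hm4 : m ≤ Real.log 4 := min_le_left _ _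
  have hmu : m ≤ u := min_le_right _ _
  have hL : 0 < Real.log 4 := by linarith
  have hc := convexOn_exp.2 (Set.mem_univ 0) (Set.mem_univ (2 * Real.log 4))
    (show 0 ≤ 1 - m / Real.log 4 by rw [sub_nonneg, div_le_one hL]; exact hm4)
    (show 0 ≤ m / Real.log 4 by positivity) (by ring)
  have e16 : Real.exp (2 * Real.log 4) = 16 := by
    rw [two_mul, Real.exp_add, Real.exp_log (by norm_num)]; norm_num
  simp only [smul_eq_mul, mul_zero, zero_add, Real.exp_zero, mul_one, e16] at hc
  have e : m / Real.log 4 * (2 * Real.log 4) = 2 * m := by field_simp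
  rw [e] at hc
  have : 15 * (m / Real.log 4) ≤ 11 * m := by
    rw [mul_div_assoc', div_le_iff₀ hL]
    nlinarith
  linarith

/-! ### Gaussian smoothing in one dimension -/

lemma integrable_pow_gaussianReal (k : ℕ) :
    Integrable (fun g : ℝ => g ^ k) (gaussianReal 0 1) := by
  have h : (0 : ℝ) ∈ interior (integrableExpSet id (gaussianReal 0 1)) := by
    simp [integrableExpSet_id_gaussianReal]
  simpa using integrable_pow_of_mem_interior_integrableExpSet h k

/-- The moments of orders one to four, read off the moment generating function `exp (t² / 2)`. -/
lemma integral_pow_gaussianReal :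
    ∫ g, g ^ 1 ∂(gaussianReal 0 1) = 0 ∧ ∫ g, g ^ 2 ∂(gaussianReal 0 1) = 1 ∧
    ∫ g, g ^ 3 ∂(gaussianReal 0 1) = 0 ∧ ∫ g, g ^ 4 ∂(gaussianReal 0 1) = 3 := by
  have h : (0 : ℝ) ∈ interior (integrableExpSet id (gaussianReal 0 1)) := by
    simp [integrableExpSet_id_gaussianReal]
  have hm : mgf id (gaussianReal 0 1) = fun t => Real.exp (t ^ 2 / 2) := by
    rw [mgf_id_gaussianReal]; simp
  have key (k : ℕ) : ∫ g, g ^ k ∂(gaussianReal 0 1)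
      = iteratedDeriv k (fun t => Real.exp (t ^ 2 / 2)) 0 := by
    rw [← hm, iteratedDeriv_mgf_zero h k]; simp
  -- the derivative of a polynomial multiple of `exp (t² / 2)` is again of this form
  have hd (P P' : ℝ → ℝ) (hP : ∀ t, HasDerivAt P (P' t) t) :
      deriv (fun t => P t * Real.exp (t ^ 2 / 2)) =
        fun t => (P' t + t * P t) * Real.exp (t ^ 2 / 2) := by
    funext t
    have h1 : HasDerivAt (fun t : ℝ => t ^ 2 / 2) t t := by
      refine ((hasDerivAt_pow 2 t).div_const 2).congr_deriv ?_
      push_cast; ring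
    refine HasDerivAt.deriv (((hP t).mul h1.exp).congr_deriv ?_)
    ring
  have d1 : iteratedDeriv 1 (fun t : ℝ => Real.exp (t ^ 2 / 2)) =
      fun t => t * Real.exp (t ^ 2 / 2) := by
    have := hd (fun _ => 1) (fun _ => 0) (fun t => hasDerivAt_const t 1)
    simpa [iteratedDeriv_one] using this
  have d2 : iteratedDeriv 2 (fun t : ℝ => Real.exp (t ^ 2 / 2)) =
      fun t => (1 + t * t) * Real.exp (t ^ 2 / 2) := by
    rw [iteratedDeriv_succ, d1, hd (fun t => t) (fun _ => 1) hasDerivAt_id']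
  have d3 : iteratedDeriv 3 (fun t : ℝ => Real.exp (t ^ 2 / 2)) =
      fun t => (2 * t + t * (1 + t * t)) * Real.exp (t ^ 2 / 2) := by
    rw [iteratedDeriv_succ, d2, hd (fun t => 1 + t * t) (fun t => 2 * t)]
    intro t
    refine (((hasDerivAt_id' t).mul (hasDerivAt_id' t)).const_add 1).congr_deriv ?_
    ring
  have d4 : iteratedDeriv 4 (fun t : ℝ => Real.exp (t ^ 2 / 2)) =
      fun t => (3 + 3 * t ^ 2 + t * (2 * t + t * (1 + t * t))) * Real.exp (t ^ 2 / 2) := by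
    rw [iteratedDeriv_succ, d3, hd (fun t => 2 * t + t * (1 + t * t)) (fun t => 3 + 3 * t ^ 2)]
    intro t
    have h1 := ((hasDerivAt_id' t).mul (hasDerivAt_id' t)).const_add (1 : ℝ)
    refine (((hasDerivAt_id' t).const_mul 2).add ((hasDerivAt_id' t).mul h1)).congr_deriv ?_
    simp
    ring
  simp only [key, d1, d2, d3, d4]
  norm_num

lemma integrable_quartic_gaussianReal (a b c d e : ℝ) :
    Integrable (fun g : ℝ => a + b * g ^ 1 + c * g ^ 2 + d * g ^ 3 + e * g ^ 4)
      (gaussianReal 0 1) := by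
  have hp := integrable_pow_gaussianReal
  exact ((((integrable_const a).add ((hp 1).const_mul b)).add ((hp 2).const_mul c)).add
    ((hp 3).const_mul d)).add ((hp 4).const_mul e)

lemma integral_quartic_gaussianReal (a b c d e : ℝ) :
    ∫ g, (a + b * g ^ 1 + c * g ^ 2 + d * g ^ 3 + e * g ^ 4) ∂(gaussianReal 0 1)
      = a + c + 3 * e := by
  have hp := integrable_pow_gaussianReal
  obtain ⟨h1, h2, h3, h4⟩ := integral_pow_gaussianReal
  have i0 : Integrable (fun _ : ℝ => a) (gaussianReal 0 1) := integrable_const a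
  have i1 := (hp 1).const_mul b
  have i2 := (hp 2).const_mul c
  have i3 := (hp 3).const_mul d
  have i4 := (hp 4).const_mul e
  have s1 : Integrable (fun g : ℝ => a + b * g ^ 1) (gaussianReal 0 1) := i0.add i1
  have s2 : Integrable (fun g : ℝ => a + b * g ^ 1 + c * g ^ 2) (gaussianReal 0 1) := s1.add i2
  have s3 : Integrable (fun g : ℝ => a + b * g ^ 1 + c * g ^ 2 + d * g ^ 3) (gaussianReal 0 1) :=
    s2.add i3
  rw [integral_add s3 i4, integral_add s2 i3, integral_add s1 i2, integral_add i0 i1,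
    integral_const_mul, integral_const_mul, integral_const_mul, integral_const_mul, h1, h2, h3, h4]
  simp
  ring

/-- A bounded function of `t = ⟨θ', x⟩`, where `θ'` is a Gaussian perturbation of `θ` and `s` is the
standard deviation of `⟨θ', x⟩`, whose Gaussian mean dominates `ψ (σ l (⟨θ, x⟩² - 1))`; the sign
`σ = ±1` selects one of the two tails. With `h = σ l (t² - s² - 1)`, a function of mean
`σ l (⟨θ, x⟩² - 1)`, the first term is the logarithm of `1 + h + h² / 2`, truncated at `log 5`, and
the second one pays for the variance of `h`. Both terms are truncated, so that no integrability
question arises in the exponential inequality. -/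
noncomputable def surrogate (σ l t s : ℝ) : ℝ :=
  min (Real.log (1 + σ * l * (t ^ 2 - s ^ 2 - 1) + (σ * l * (t ^ 2 - s ^ 2 - 1)) ^ 2 / 2))
      (Real.log 5)
    + 2 * min (Real.log 4) (l ^ 2 * (4 * t ^ 2 * s ^ 2 + 2 * s ^ 4) / 5)

lemma measurable_surrogate {α : Type*} [MeasurableSpace α] (σ l : ℝ) {f g : α → ℝ}
    (hf : Measurable f) (hg : Measurable g) : Measurable fun a => surrogate σ l (f a) (g a) := by
  unfold surrogate
  fun_prop

lemma abs_surrogate_le (σ l t s : ℝ) :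
    |surrogate σ l t s| ≤ Real.log 2 + Real.log 5 + 2 * Real.log 4 := by
  unfold surrogate
  set h := σ * l * (t ^ 2 - s ^ 2 - 1)
  have h1 : -Real.log 2 ≤ min (Real.log (1 + h + h ^ 2 / 2)) (Real.log 5) := by
    rw [← Real.log_inv]
    exact le_min (Real.log_le_log (by norm_num) (by linarith [half_le_quad h]))
      (Real.log_le_log (by norm_num) (by norm_num))
  have h2 : 0 ≤ min (Real.log 4) (l ^ 2 * (4 * t ^ 2 * s ^ 2 + 2 * s ^ 4) / 5) :=
    le_min (Real.log_nonneg (by norm_num)) (by positivity)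
  have h3 := min_le_right (Real.log (1 + h + h ^ 2 / 2)) (Real.log 5)
  have h4 := min_le_left (Real.log 4) (l ^ 2 * (4 * t ^ 2 * s ^ 2 + 2 * s ^ 4) / 5)
  have h5 : 0 ≤ Real.log 2 := Real.log_nonneg (by norm_num)
  have h6 : 0 ≤ Real.log 5 := Real.log_nonneg (by norm_num)
  rw [abs_le]
  constructor <;> linarith

lemma abs_exp_surrogate_le (σ l t s : ℝ) :
    |Real.exp (surrogate σ l t s)| ≤ Real.exp (Real.log 2 + Real.log 5 + 2 * Real.log 4) := by
  rw [abs_of_pos (Real.exp_pos _)]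
  exact Real.exp_le_exp.2 ((le_abs_self _).trans (abs_surrogate_le σ l t s))

/-- The truncation of the first term of `surrogate` at `log 5` is what allows the variance term to
be added to, rather than multiplied with, `1 + h + h² / 2`. -/
lemma exp_surrogate_le (σ l t s : ℝ) :
    Real.exp (surrogate σ l t s) ≤
      1 + σ * l * (t ^ 2 - s ^ 2 - 1) + (σ * l * (t ^ 2 - s ^ 2 - 1)) ^ 2 / 2
        + l ^ 2 * (44 * t ^ 2 * s ^ 2 + 22 * s ^ 4) := by
  unfold surrogate
  set h := σ * l * (t ^ 2 - s ^ 2 - 1)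
  set u := l ^ 2 * (4 * t ^ 2 * s ^ 2 + 2 * s ^ 4) / 5 with hu
  have hu0 : 0 ≤ u := by positivity
  have hq := quad_pos h
  have h1 : Real.exp (min (Real.log (1 + h + h ^ 2 / 2)) (Real.log 5)) ≤ 1 + h + h ^ 2 / 2 := by
    conv_rhs => rw [← Real.exp_log hq]
    exact Real.exp_le_exp.2 (min_le_left _ _)
  have h2 : Real.exp (min (Real.log (1 + h + h ^ 2 / 2)) (Real.log 5)) ≤ 5 := by
    conv_rhs => rw [← Real.exp_log (show (0 : ℝ) < 5 by norm_num)]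
    exact Real.exp_le_exp.2 (min_le_right _ _)
  rw [Real.exp_add]
  calc _ ≤ Real.exp (min (Real.log (1 + h + h ^ 2 / 2)) (Real.log 5)) * (1 + 11 * u) :=
        mul_le_mul_of_nonneg_left (exp_two_mul_min_le hu0) (Real.exp_pos _).le
    _ ≤ (1 + h + h ^ 2 / 2) + 5 * (11 * u) := by nlinarith
    _ = _ := by rw [hu]; ring

lemma integrable_of_abs_le {α : Type*} [MeasurableSpace α] {ν : Measure α} [IsFiniteMeasure ν]
    {f : α → ℝ} (hf : Measurable f) {c : ℝ} (hc : ∀ x, |f x| ≤ c) : Integrable f ν :=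
  Integrable.of_bound hf.aestronglyMeasurable c (Filter.Eventually.of_forall hc)

/-- The truncated variance term at the centre `m` is at most twice its Gaussian mean: one of
`(m + s g)²` and `(m - s g)²` is at least `m²`. -/
lemma min_le_two_mul_integral (l m s : ℝ) :
    min (Real.log 4) (l ^ 2 * (4 * m ^ 2 * s ^ 2 + 2 * s ^ 4) / 5) ≤
      ∫ g, 2 * min (Real.log 4) (l ^ 2 * (4 * (m + s * g) ^ 2 * s ^ 2 + 2 * s ^ 4) / 5)
        ∂(gaussianReal 0 1) := by
  set u : ℝ → ℝ := fun t => min (Real.log 4) (l ^ 2 * (4 * t ^ 2 * s ^ 2 + 2 * s ^ 4) / 5) with hu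
  have hmeas : Measurable u := by rw [hu]; fun_prop
  have h4 : 0 ≤ Real.log 4 := Real.log_nonneg (by norm_num)
  have hu0 (t : ℝ) : 0 ≤ u t := le_min h4 (by positivity)
  have hmono {a b : ℝ} (hab : a ^ 2 ≤ b ^ 2) : u a ≤ u b := by
    refine min_le_min le_rfl ?_
    gcongr
  have hb (t : ℝ) : |u t| ≤ Real.log 4 := by
    rw [abs_of_nonneg (hu0 t)]; exact min_le_left _ _
  have i1 : Integrable (fun g => u (m + s * g)) (gaussianReal 0 1) :=
    integrable_of_abs_le (hmeas.comp (by fun_prop)) (fun g => hb _)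
  have i2 : Integrable (fun g => u (m + s * -g)) (gaussianReal 0 1) :=
    integrable_of_abs_le (hmeas.comp (by fun_prop)) (fun g => hb _)
  have hsymm : ∫ g, u (m + s * -g) ∂(gaussianReal 0 1) = ∫ g, u (m + s * g) ∂(gaussianReal 0 1) := by
    have hn : (gaussianReal 0 1).map (fun x : ℝ => -x) = gaussianReal 0 1 := by
      rw [gaussianReal_map_neg, neg_zero]
    have hmeas' : Measurable fun g : ℝ => u (m + s * g) := hmeas.comp (by fun_prop)
    conv_rhs => rw [← hn]
    rw [integral_map measurable_neg.aemeasurable hmeas'.aestronglyMeasurable]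
  have : ∫ _g : ℝ, u m ∂(gaussianReal 0 1) ≤
      ∫ g, (u (m + s * g) + u (m + s * -g)) ∂(gaussianReal 0 1) := by
    refine integral_mono (integrable_const _) (i1.add i2) fun g => ?_
    rcases le_total 0 (m * (s * g)) with h | h
    · have := hmono (show m ^ 2 ≤ (m + s * g) ^ 2 by nlinarith [sq_nonneg (s * g)])
      have := hu0 (m + s * -g)
      simp only
      linarith
    · have := hmono (show m ^ 2 ≤ (m + s * -g) ^ 2 by nlinarith [sq_nonneg (s * g)])
      have := hu0 (m + s * g)
      simp only
      linarith
  rw [integral_add i1 i2, hsymm] at this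
  simp only [integral_const, probReal_univ, one_smul] at this
  change u m ≤ ∫ g, 2 * u (m + s * g) ∂(gaussianReal 0 1)
  rw [integral_const_mul]
  linarith

/-- If the variance `V` of `h` is small, the parabola of `exists_parabola_le` loses only `V / 5`,
which the second term of `surrogate` recovers; otherwise that term is worth `log 4` in the mean, and
`ψ ≤ log 2 = log 4 - log 2` while the first term is at least `-log 2`. -/
theorem psi_le_integral_surrogate {σ : ℝ} (hσ : σ ^ 2 = 1) (l m s : ℝ) :
    psi (σ * l * (m ^ 2 - 1)) ≤ ∫ g, surrogate σ l (m + s * g) s ∂(gaussianReal 0 1) := by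
  set z := σ * l * (m ^ 2 - 1) with hz
  set V := l ^ 2 * (4 * m ^ 2 * s ^ 2 + 2 * s ^ 4) with hV
  set H : ℝ → ℝ := fun g => σ * l * ((m + s * g) ^ 2 - s ^ 2 - 1) with hH
  set A : ℝ → ℝ := fun g => min (Real.log (1 + H g + H g ^ 2 / 2)) (Real.log 5) with hA
  set B : ℝ → ℝ := fun g =>
    2 * min (Real.log 4) (l ^ 2 * (4 * (m + s * g) ^ 2 * s ^ 2 + 2 * s ^ 4) / 5) with hB
  have h4 : Real.log 4 = 2 * Real.log 2 := by
    rw [two_mul, ← Real.log_mul (by norm_num) (by norm_num)]; norm_num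
  have h2 : 0 ≤ Real.log 2 := Real.log_nonneg (by norm_num)
  have hA2 (g : ℝ) : -Real.log 2 ≤ A g := by
    rw [← Real.log_inv]
    exact le_min (Real.log_le_log (by norm_num) (by linarith [half_le_quad (H g)]))
      (Real.log_le_log (by norm_num) (by norm_num))
  have hA5 (g : ℝ) : A g ≤ Real.log 5 := min_le_right _ _
  have h5 : Real.log 2 ≤ Real.log 5 := Real.log_le_log (by norm_num) (by norm_num)
  have iA : Integrable A (gaussianReal 0 1) :=
    integrable_of_abs_le (c := Real.log 5) (by rw [hA, hH]; fun_prop)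
      (fun g => abs_le.2 ⟨by linarith [hA2 g], hA5 g⟩)
  have iB : Integrable B (gaussianReal 0 1) := by
    refine integrable_of_abs_le (c := 2 * Real.log 4) (by rw [hB]; fun_prop) (fun g => ?_)
    have : 0 ≤ min (Real.log 4) (l ^ 2 * (4 * (m + s * g) ^ 2 * s ^ 2 + 2 * s ^ 4) / 5) :=
      le_min (by linarith) (by positivity)
    rw [abs_of_nonneg (by positivity)]
    exact mul_le_mul_of_nonneg_left (min_le_left _ _) (by norm_num)
  have hsum : ∫ g, surrogate σ l (m + s * g) s ∂(gaussianReal 0 1)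
      = ∫ g, A g ∂(gaussianReal 0 1) + ∫ g, B g ∂(gaussianReal 0 1) := by
    rw [← integral_add iA iB]; rfl
  have hBle : min (Real.log 4) (V / 5) ≤ ∫ g, B g ∂(gaussianReal 0 1) :=
    min_le_two_mul_integral l m s
  rw [hsum]
  -- The Gaussian variable `H` has mean `z` and variance `V`.
  rcases le_total (V / 5) (Real.log 4) with hc | hc
  · rw [min_eq_right hc] at hBle
    obtain ⟨p, hp⟩ := exists_parabola_le z
    have hle : ∫ g, (psi z + p * (H g - z) - (H g - z) ^ 2 / 5) ∂(gaussianReal 0 1)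
        ≤ ∫ g, A g ∂(gaussianReal 0 1) := by
      refine integral_mono ?_ iA fun g => hp (H g)
      refine (integrable_quartic_gaussianReal
        (psi z - p * (σ * l * s ^ 2) - (σ * l * s ^ 2) ^ 2 / 5)
        (p * (2 * σ * l * m * s) + 2 * (σ * l * s ^ 2) * (2 * σ * l * m * s) / 5)
        (p * (σ * l * s ^ 2) - (2 * σ * l * m * s) ^ 2 / 5 + 2 * (σ * l * s ^ 2) ^ 2 / 5)
        (-(2 * (σ * l * s ^ 2) * (2 * σ * l * m * s)) / 5)
        (-(σ * l * s ^ 2) ^ 2 / 5)).congr (Filter.Eventually.of_forall fun g => ?_)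
      simp only [hH, hz]
      ring
    have heq : ∫ g, (psi z + p * (H g - z) - (H g - z) ^ 2 / 5) ∂(gaussianReal 0 1)
        = psi z - V / 5 := by
      have := integral_quartic_gaussianReal
        (psi z - p * (σ * l * s ^ 2) - (σ * l * s ^ 2) ^ 2 / 5)
        (p * (2 * σ * l * m * s) + 2 * (σ * l * s ^ 2) * (2 * σ * l * m * s) / 5)
        (p * (σ * l * s ^ 2) - (2 * σ * l * m * s) ^ 2 / 5 + 2 * (σ * l * s ^ 2) ^ 2 / 5)
        (-(2 * (σ * l * s ^ 2) * (2 * σ * l * m * s)) / 5)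
        (-(σ * l * s ^ 2) ^ 2 / 5)
      calc _ = _ := integral_congr_ae (Filter.Eventually.of_forall fun g => by
              simp only [hH, hz]; ring)
        _ = _ := this
        _ = psi z - σ ^ 2 * (V / 5) := by rw [hV]; ring
        _ = _ := by rw [hσ, one_mul]
    linarith
  · rw [min_eq_left hc] at hBle
    have : ∫ _g : ℝ, -Real.log 2 ∂(gaussianReal 0 1) ≤ ∫ g, A g ∂(gaussianReal 0 1) :=
      integral_mono (integrable_const _) iA hA2
    simp only [integral_const, probReal_univ, one_smul] at this
    linarith [psi_le_log_two z]

lemma integrable_exp_surrogate (σ l m s : ℝ) :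
    Integrable (fun g : ℝ => Real.exp (surrogate σ l (m + s * g) s)) (gaussianReal 0 1) := by
  have h2 : Measurable (fun g : ℝ => Real.exp (surrogate σ l (m + s * g) s)) :=
    (measurable_surrogate σ l (by fun_prop) measurable_const).exp
  refine integrable_of_abs_le h2 (c := Real.exp (Real.log 2 + Real.log 5 + 2 * Real.log 4)) ?_
  intro g
  exact abs_exp_surrogate_le σ l (m + s * g) s

theorem integral_exp_surrogate_le {σ : ℝ} (hσ : σ ^ 2 = 1) (l m s : ℝ) :
    ∫ g, Real.exp (surrogate σ l (m + s * g) s) ∂(gaussianReal 0 1) ≤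
      1 + σ * l * (m ^ 2 - 1) + l ^ 2 / 2 * (m ^ 2 - 1) ^ 2
        + l ^ 2 * (46 * (m ^ 2 * s ^ 2) + 67 * s ^ 4) := by
  set a := σ * l * (m ^ 2 - s ^ 2 - 1) with ha
  set b := 2 * σ * l * m * s with hb
  set c := σ * l * s ^ 2 with hc
  set f : ℝ → ℝ := fun g => (1 + a + a ^ 2 / 2 + l ^ 2 * (44 * m ^ 2 * s ^ 2 + 22 * s ^ 4))
    + (b + a * b + l ^ 2 * (88 * m * s ^ 3)) * g ^ 1
    + (c + a * c + b ^ 2 / 2 + l ^ 2 * (44 * s ^ 4)) * g ^ 2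
    + (b * c) * g ^ 3 + (c ^ 2 / 2) * g ^ 4 with hf
  have hle : ∫ g, Real.exp (surrogate σ l (m + s * g) s) ∂(gaussianReal 0 1) ≤
      ∫ g, f g ∂(gaussianReal 0 1) := by
    refine integral_mono ?_ (integrable_quartic_gaussianReal _ _ _ _ _) fun g => ?_
    · exact integrable_exp_surrogate σ l m s
    · refine (exp_surrogate_le σ l (m + s * g) s).trans (le_of_eq ?_)
      simp only [hf, ha, hb, hc]
      ring
  refine hle.trans (le_of_eq ?_)
  rw [hf, integral_quartic_gaussianReal]
  calc _ = 1 + σ * l * (m ^ 2 - 1) + σ ^ 2 * (l ^ 2 / 2 * (m ^ 2 - 1) ^ 2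
        + l ^ 2 * (2 * (m ^ 2 * s ^ 2) + s ^ 4))
        + l ^ 2 * (44 * (m ^ 2 * s ^ 2) + 66 * s ^ 4) := by
        rw [ha, hb, hc]; ring
    _ = _ := by rw [hσ]; ring

/-! ### Change of measure and the PAC-Bayes inequality -/

lemma gaussianReal_map_add_eq_withDensity (b : ℝ) :
    (gaussianReal 0 1).map (· + b) =
      (gaussianReal 0 1).withDensity (fun w => ENNReal.ofReal (Real.exp (b * w - b ^ 2 / 2))) := by
  rw [gaussianReal_map_add_const, gaussianReal_of_var_ne_zero _ one_ne_zero,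
    gaussianReal_of_var_ne_zero _ one_ne_zero,
    ← withDensity_mul _ (measurable_gaussianPDF _ _) (by fun_prop)]
  congr 1
  funext w
  simp only [Pi.mul_apply, gaussianPDF, gaussianPDFReal]
  rw [← ENNReal.ofReal_mul (by positivity)]
  conv_rhs => rw [mul_assoc, ← Real.exp_add]
  congr 3
  simp
  ring

lemma pi_gaussianReal_map_add_eq_withDensity {ι : Type*} [Fintype ι] (b : ι → ℝ) :
    (Measure.pi fun _ : ι => gaussianReal 0 1).map (· + b) =
      (Measure.pi fun _ : ι => gaussianReal 0 1).withDensity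
        (fun w => ∏ i, ENNReal.ofReal (Real.exp (b i * w i - b i ^ 2 / 2))) := by
  set ρ : ι → ℝ → ℝ≥0∞ := fun i w => ENNReal.ofReal (Real.exp (b i * w - b i ^ 2 / 2)) with hρ
  have hρm (i : ι) : Measurable (ρ i) := by rw [hρ]; fun_prop
  have h1 : (Measure.pi fun _ : ι => gaussianReal 0 1).map (· + b) =
      Measure.pi fun i => (gaussianReal 0 1).map (· + b i) := by
    have := Measure.pi_map_pi (μ := fun _ : ι => gaussianReal 0 1) (f := fun i x => x + b i)
      (fun i => (measurable_add_const (b i)).aemeasurable)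
    exact this
  rw [h1]
  refine Measure.pi_eq fun s hs => ?_
  rw [withDensity_apply _ (MeasurableSet.univ_pi hs),
    ← lintegral_indicator (MeasurableSet.univ_pi hs)]
  have h2 (w : ι → ℝ) : (Set.univ.pi s).indicator (fun w => ∏ i, ρ i (w i)) w =
      ∏ i, (s i).indicator (ρ i) (w i) := by
    by_cases hw : w ∈ Set.univ.pi s
    · rw [Set.indicator_of_mem hw]
      exact Finset.prod_congr rfl fun i _ => (Set.indicator_of_mem (hw i trivial) _).symm
    · rw [Set.indicator_of_notMem hw]
      simp only [Set.mem_pi, Set.mem_univ, true_implies, not_forall] at hw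
      obtain ⟨i, hi⟩ := hw
      exact (Finset.prod_eq_zero (Finset.mem_univ i) (Set.indicator_of_notMem hi _)).symm
  have hind := iIndepFun_pi (μ := fun _ : ι => gaussianReal 0 1)
    (X := fun i => (s i).indicator (ρ i)) (fun i => ((hρm i).indicator (hs i)).aemeasurable)
  rw [lintegral_congr h2, lintegral_prod_eq_prod_lintegral_of_indepFun Finset.univ
    (fun i (w : ι → ℝ) => (s i).indicator (ρ i) (w i)) hind
    (fun i => ((hρm i).indicator (hs i)).comp (measurable_pi_apply i))]
  refine Finset.prod_congr rfl fun i _ => ?_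
  rw [gaussianReal_map_add_eq_withDensity, withDensity_apply _ (hs i),
    ← lintegral_indicator (hs i)]
  exact (measurePreserving_eval (fun _ : ι => gaussianReal 0 1) i).lintegral_comp
    ((hρm i).indicator (hs i))

variable {d : ℕ}

/-- The Cameron–Martin formula for the standard Gaussian measure. -/
lemma stdGaussian_map_add_eq_withDensity (b : EuclideanSpace ℝ (Fin d)) :
    (stdGaussian (EuclideanSpace ℝ (Fin d))).map (· + b) =
      (stdGaussian (EuclideanSpace ℝ (Fin d))).withDensity
        (fun w => ENNReal.ofReal (Real.exp (inner ℝ b w - ‖b‖ ^ 2 / 2))) := by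
  have hm : Measurable (WithLp.toLp 2 : (Fin d → ℝ) → EuclideanSpace ℝ (Fin d)) := by fun_prop
  rw [← map_pi_eq_stdGaussian, Measure.map_map (by fun_prop) hm]
  have h1 : ((· + b) ∘ WithLp.toLp 2 : (Fin d → ℝ) → EuclideanSpace ℝ (Fin d)) =
      WithLp.toLp 2 ∘ (· + (fun i => b i)) := by
    funext w; ext i; simp
  rw [h1, ← Measure.map_map hm (by fun_prop), pi_gaussianReal_map_add_eq_withDensity]
  ext s hs
  rw [Measure.map_apply hm hs, withDensity_apply _ (hm hs), withDensity_apply _ hs,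
    setLIntegral_map hs (by fun_prop) hm]
  refine lintegral_congr fun w => ?_
  rw [← ENNReal.ofReal_prod_of_nonneg (fun i _ => (Real.exp_pos _).le), ← Real.exp_sum]
  congr 2
  rw [Finset.sum_sub_distrib, EuclideanSpace.real_norm_sq_eq, Finset.sum_div]
  simp [PiLp.inner_apply, mul_comm]

/-- The Donsker–Varadhan inequality for a translated Gaussian measure, whose relative entropy with
respect to the centred one is `‖b‖² / 2`. -/
theorem exp_integral_shift_le {φ : EuclideanSpace ℝ (Fin d) → ℝ} (hφ : Measurable φ) {c : ℝ}
    (hc : ∀ w, |φ w| ≤ c) (b : EuclideanSpace ℝ (Fin d)) :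
    Real.exp (∫ w, φ (w + b) ∂(stdGaussian _) - ‖b‖ ^ 2 / 2) ≤
      ∫ w, Real.exp (φ w) ∂(stdGaussian (EuclideanSpace ℝ (Fin d))) := by
  set γ := stdGaussian (EuclideanSpace ℝ (Fin d)) with hγ
  set ρ : EuclideanSpace ℝ (Fin d) → ℝ≥0∞ :=
    fun w => ENNReal.ofReal (Real.exp (inner ℝ (-b) w - ‖-b‖ ^ 2 / 2)) with hρ
  have hρm : Measurable ρ := by rw [hρ]; fun_prop
  have hmap : γ.map (· + -b) = γ.withDensity ρ := stdGaussian_map_add_eq_withDensity (-b)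
  have hem : Measurable fun w => Real.exp (φ (w + b)) :=
    Real.measurable_exp.comp (hφ.comp (measurable_add_const b))
  have hchange : ∫ w, Real.exp (φ w) ∂γ =
      ∫ w, Real.exp (φ (w + b) - inner ℝ b w - ‖b‖ ^ 2 / 2) ∂γ := by
    have h1 : ∫ w, Real.exp (φ (w + b)) ∂(γ.map (· + -b)) = ∫ w, Real.exp (φ w) ∂γ := by
      rw [integral_map (by fun_prop) hem.aestronglyMeasurable]
      simp
    rw [← h1, hmap, integral_withDensity_eq_integral_toReal_smul hρm
      (Filter.Eventually.of_forall fun w => ENNReal.ofReal_lt_top)]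
    refine integral_congr_ae (Filter.Eventually.of_forall fun w => ?_)
    simp only [hρ, smul_eq_mul]
    rw [ENNReal.toReal_ofReal (Real.exp_pos _).le, ← Real.exp_add, norm_neg, inner_neg_left]
    congr 1
    ring
  have hint : Integrable (fun w => Real.exp (φ (w + b) - inner ℝ b w - ‖b‖ ^ 2 / 2)) γ := by
    have h2 : Integrable (fun w => Real.exp (φ (w + b))) (γ.withDensity ρ) := by
      rw [← hmap]
      have : IsProbabilityMeasure (γ.map (· + -b)) :=
        Measure.isProbabilityMeasure_map (by fun_prop)
      refine integrable_of_abs_le hem (c := Real.exp c) fun w => ?_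
      rw [abs_of_pos (Real.exp_pos _)]
      exact Real.exp_le_exp.2 ((le_abs_self _).trans (hc _))
    rw [integrable_withDensity_iff_integrable_smul' hρm
      (Filter.Eventually.of_forall fun w => ENNReal.ofReal_lt_top)] at h2
    refine h2.congr (Filter.Eventually.of_forall fun w => ?_)
    simp only [hρ, smul_eq_mul]
    rw [ENNReal.toReal_ofReal (Real.exp_pos _).le, ← Real.exp_add, norm_neg, inner_neg_left]
    congr 1
    ring
  have hint1 : Integrable (fun w => φ (w + b)) γ :=
    integrable_of_abs_le (hφ.comp (measurable_add_const b)) fun w => hc _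
  have hint2 : Integrable (fun w : EuclideanSpace ℝ (Fin d) => (inner ℝ b w : ℝ)) γ :=
    (IsGaussian.integrable_id (μ := γ)).const_inner b
  have h0 : ∫ w, (inner ℝ b w : ℝ) ∂γ = 0 := by
    have := integral_inner (𝕜 := ℝ) (IsGaussian.integrable_id (μ := γ)) b
    simpa [hγ] using this
  have hint3 : Integrable (fun w => φ (w + b) - inner ℝ b w - ‖b‖ ^ 2 / 2) γ :=
    (hint1.sub hint2).sub (integrable_const _)
  have hmean : ∫ w, (φ (w + b) - inner ℝ b w - ‖b‖ ^ 2 / 2) ∂γ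
      = ∫ w, φ (w + b) ∂γ - ‖b‖ ^ 2 / 2 := by
    have h4 : Integrable (fun w => φ (w + b) - inner ℝ b w) γ := hint1.sub hint2
    rw [integral_sub h4 (integrable_const _), integral_sub hint1 hint2, h0]
    simp
  rw [← hmean, hchange]
  exact convexOn_exp.map_integral_le Real.continuous_exp.continuousOn isClosed_univ
    (Filter.Eventually.of_forall fun _ => Set.mem_univ _) hint3 hint

/-- The PAC-Bayes inequality with a standard Gaussian prior and its translates as posteriors: an
exponential inequality for the empirical sums of `H w`, averaged over `w`, that holds for all
translations at once. The event is `{Z < ε⁻¹}` for a nonnegative random variable `Z` of mean one. -/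
theorem exists_event_pac_bayes {S : Type*} [MeasurableSpace S] (P : Measure S)
    [IsProbabilityMeasure P] (n : ℕ) {H : EuclideanSpace ℝ (Fin d) → S → ℝ}
    (hH : Measurable (Function.uncurry H)) {c : ℝ} (hc : ∀ w x, |H w x| ≤ c)
    {ε : ℝ} (hε : 0 < ε) :
    ∃ A : Set (Fin n → S), MeasurableSet A ∧
      ENNReal.ofReal (1 - ε) ≤ Measure.pi (fun _ => P) A ∧
      ∀ x ∈ A, ∀ b : EuclideanSpace ℝ (Fin d),
        ∑ i, ∫ w, H (w + b) (x i) ∂(stdGaussian _) <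
          n * (∫ w, ∫ y, Real.exp (H (w + b) y) ∂P ∂(stdGaussian _) - 1)
            + ‖b‖ ^ 2 / 2 + Real.log ε⁻¹ := by
  set γ := stdGaussian (EuclideanSpace ℝ (Fin d)) with hγ
  have hHw (w : EuclideanSpace ℝ (Fin d)) : Measurable (H w) := hH.comp measurable_prodMk_left
  have hHx (x : S) : Measurable (fun w => H w x) := hH.comp measurable_prodMk_right
  have heH (w : EuclideanSpace ℝ (Fin d)) (x : S) : Real.exp (H w x) ≤ Real.exp c :=
    Real.exp_le_exp.2 ((le_abs_self _).trans (hc w x))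
  have heH' (w : EuclideanSpace ℝ (Fin d)) (x : S) : Real.exp (-c) ≤ Real.exp (H w x) :=
    Real.exp_le_exp.2 (abs_le.1 (hc w x)).1
  have hiw (w : EuclideanSpace ℝ (Fin d)) : Integrable (fun x => Real.exp (H w x)) P :=
    integrable_of_abs_le (hHw w).exp fun x => by
      rw [abs_of_pos (Real.exp_pos _)]; exact heH w x
  set Q : EuclideanSpace ℝ (Fin d) → ℝ := fun w => ∫ y, Real.exp (H w y) ∂P with hQ
  have hQm : Measurable Q :=
    (StronglyMeasurable.integral_prod_right (f := fun w y => Real.exp (H w y))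
      hH.exp.stronglyMeasurable).measurable
  have hQle (w : EuclideanSpace ℝ (Fin d)) : Q w ≤ Real.exp c := by
    have := integral_mono (hiw w) (integrable_const _) (heH w)
    simpa using this
  have hQge (w : EuclideanSpace ℝ (Fin d)) : Real.exp (-c) ≤ Q w := by
    have := integral_mono (integrable_const _) (hiw w) (heH' w)
    simpa using this
  have hQpos (w : EuclideanSpace ℝ (Fin d)) : 0 < Q w := (Real.exp_pos _).trans_le (hQge w)
  have hlogQ (w : EuclideanSpace ℝ (Fin d)) : |Real.log (Q w)| ≤ c := by
    rw [abs_le]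
    exact ⟨(Real.le_log_iff_exp_le (hQpos w)).2 (hQge w),
      (Real.log_le_iff_le_exp (hQpos w)).2 (hQle w)⟩
  set φ : (Fin n → S) → EuclideanSpace ℝ (Fin d) → ℝ :=
    fun x w => ∑ i, H w (x i) - n * Real.log (Q w) with hφ
  have hφm : Measurable (Function.uncurry φ) := by
    refine Measurable.sub (Finset.measurable_sum _ fun i _ => ?_)
      ((hQm.comp measurable_snd).log.const_mul _)
    have : Measurable fun p : (Fin n → S) × EuclideanSpace ℝ (Fin d) => (p.2, p.1 i) := by fun_prop
    exact hH.comp this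
  have hφb (x : Fin n → S) (w : EuclideanSpace ℝ (Fin d)) : |φ x w| ≤ n * c + n * c := by
    have h1 : |∑ i, H w (x i)| ≤ n * c := by
      refine (Finset.abs_sum_le_sum_abs _ _).trans ?_
      refine (Finset.sum_le_sum fun i _ => hc w (x i)).trans ?_
      simp
    have h2 : |n * Real.log (Q w)| ≤ n * c := by
      rw [abs_mul, Nat.abs_cast]
      exact mul_le_mul_of_nonneg_left (hlogQ w) (Nat.cast_nonneg n)
    exact (abs_sub _ _).trans (add_le_add h1 h2)
  have hexpb (x : Fin n → S) (w : EuclideanSpace ℝ (Fin d)) :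
      |Real.exp (φ x w)| ≤ Real.exp (n * c + n * c) := by
    rw [abs_of_pos (Real.exp_pos _)]
    exact Real.exp_le_exp.2 ((le_abs_self _).trans (hφb x w))
  set Z : (Fin n → S) → ℝ := fun x => ∫ w, Real.exp (φ x w) ∂γ with hZ
  have hZm : Measurable Z :=
    (StronglyMeasurable.integral_prod_right (f := fun x w => Real.exp (φ x w))
      hφm.exp.stronglyMeasurable).measurable
  have hprod : Integrable (Function.uncurry fun x w => Real.exp (φ x w))
      ((Measure.pi fun _ : Fin n => P).prod γ) :=
    integrable_of_abs_le hφm.exp fun p => hexpb p.1 p.2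
  have hZint : Integrable Z (Measure.pi fun _ : Fin n => P) := hprod.integral_prod_left
  have hZ1 : ∫ x, Z x ∂(Measure.pi fun _ : Fin n => P) = 1 := by
    rw [hZ, integral_integral_swap hprod]
    have hin (w : EuclideanSpace ℝ (Fin d)) :
        ∫ x, Real.exp (φ x w) ∂(Measure.pi fun _ : Fin n => P) = 1 := by
      have h1 (x : Fin n → S) : Real.exp (φ x w) = ∏ i, Real.exp (H w (x i)) / Q w := by
        rw [hφ]
        simp only
        rw [Finset.prod_div_distrib, Real.exp_sub, Real.exp_sum, Finset.prod_const,
          Finset.card_univ, Fintype.card_fin, Real.exp_nat_mul, Real.exp_log (hQpos w)]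
      simp_rw [h1]
      rw [integral_fintype_prod_eq_prod (fun (_ : Fin n) (y : S) => Real.exp (H w y) / Q w)]
      refine Finset.prod_eq_one fun i _ => ?_
      rw [integral_div]
      exact div_self (hQpos w).ne'
    simp [hin]
  have hZ0 (x : Fin n → S) : 0 ≤ Z x := integral_nonneg fun w => (Real.exp_pos _).le
  refine ⟨{x | Z x < ε⁻¹}, measurableSet_lt hZm measurable_const, ?_, ?_⟩
  · have hmarkov := mul_meas_ge_le_integral_of_nonneg
      (Filter.Eventually.of_forall hZ0) hZint ε⁻¹
    rw [hZ1] at hmarkov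
    have hcompl : {x | Z x < ε⁻¹} = {x | ε⁻¹ ≤ Z x}ᶜ := by ext x; simp
    rw [hcompl]
    refine ENNReal.ofReal_le_of_le_toReal ?_
    change 1 - ε ≤ (Measure.pi fun _ : Fin n => P).real _
    rw [probReal_compl_eq_one_sub (measurableSet_le measurable_const hZm)]
    have : (Measure.pi fun _ : Fin n => P).real {x | ε⁻¹ ≤ Z x} ≤ ε := by
      rwa [inv_mul_le_iff₀ hε, mul_one] at hmarkov
    linarith
  · intro x hx b
    have hx' : Z x < ε⁻¹ := hx
    have hφx : Measurable (φ x) := hφm.comp measurable_prodMk_left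
    have h1 := exp_integral_shift_le hφx (hφb x) b
    have h2 : ∫ w, φ x (w + b) ∂γ - ‖b‖ ^ 2 / 2 < Real.log ε⁻¹ :=
      (Real.lt_log_iff_exp_lt (by positivity)).2 (h1.trans_lt hx')
    have hQb : Measurable fun w => Q (w + b) := hQm.comp (measurable_add_const b)
    have i1 (i : Fin n) : Integrable (fun w => H (w + b) (x i)) γ :=
      integrable_of_abs_le ((hHx (x i)).comp (measurable_add_const b)) fun w => hc _ _
    have i2 : Integrable (fun w => Real.log (Q (w + b))) γ :=
      integrable_of_abs_le hQb.log fun w => hlogQ _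
    have i3 : Integrable (fun w => Q (w + b)) γ :=
      integrable_of_abs_le hQb (c := Real.exp c) fun w => by
        rw [abs_of_pos (hQpos _)]; exact hQle _
    have h3 : ∫ w, φ x (w + b) ∂γ =
        ∑ i, ∫ w, H (w + b) (x i) ∂γ - n * ∫ w, Real.log (Q (w + b)) ∂γ := by
      rw [hφ]
      simp only
      rw [integral_sub (integrable_finsetSum _ fun i _ => i1 i) (i2.const_mul _),
        integral_finsetSum _ fun i _ => i1 i, integral_const_mul]
    have h4 : ∫ w, Real.log (Q (w + b)) ∂γ ≤ ∫ w, Q (w + b) ∂γ - 1 := by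
      have : ∫ w, Real.log (Q (w + b)) ∂γ ≤ ∫ w, (Q (w + b) - 1) ∂γ :=
        integral_mono i2 (i3.sub (integrable_const _)) fun w => Real.log_le_sub_one_of_pos (hQpos _)
      rwa [integral_sub i3 (integrable_const _), integral_const, probReal_univ, one_smul] at this
    have h5 : (n : ℝ) * ∫ w, Real.log (Q (w + b)) ∂γ ≤ n * (∫ w, Q (w + b) ∂γ - 1) :=
      mul_le_mul_of_nonneg_left h4 (Nat.cast_nonneg n)
    rw [h3] at h2
    linarith

/-! ### Whitening and fourth moments -/

variable {P : Measure (EuclideanSpace ℝ (Fin d))}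

lemma integrable_inner_mul_inner (hP : Integrable (fun x => ‖x‖ ^ 2) P)
    (θ η : EuclideanSpace ℝ (Fin d)) :
    Integrable (fun x => (inner ℝ θ x : ℝ) * inner ℝ η x) P := by
  refine (hP.const_mul (‖θ‖ * ‖η‖)).mono' (by fun_prop) (Filter.Eventually.of_forall fun x => ?_)
  rw [Real.norm_eq_abs, abs_mul]
  calc |(inner ℝ θ x : ℝ)| * |(inner ℝ η x : ℝ)| ≤ (‖θ‖ * ‖x‖) * (‖η‖ * ‖x‖) :=
        mul_le_mul (abs_real_inner_le_norm θ x) (abs_real_inner_le_norm η x) (abs_nonneg _)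
          (by positivity)
    _ = ‖θ‖ * ‖η‖ * ‖x‖ ^ 2 := by ring

/-- The Gram form `(θ, η) ↦ E ⟨θ, X⟩ ⟨η, X⟩`, whose quadratic form is the energy. -/
noncomputable def gramForm (P : Measure (EuclideanSpace ℝ (Fin d)))
    (hP : Integrable (fun x => ‖x‖ ^ 2) P) : LinearMap.BilinForm ℝ (EuclideanSpace ℝ (Fin d)) :=
  LinearMap.mk₂ ℝ (fun θ η => ∫ x, (inner ℝ θ x : ℝ) * inner ℝ η x ∂P)
    (fun θ₁ θ₂ η => by
      rw [← integral_add (integrable_inner_mul_inner hP _ _) (integrable_inner_mul_inner hP _ _)]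
      simp only [inner_add_left, add_mul])
    (fun c θ η => by
      rw [smul_eq_mul, ← integral_const_mul]
      simp only [real_inner_smul_left, mul_assoc])
    (fun θ η₁ η₂ => by
      rw [← integral_add (integrable_inner_mul_inner hP _ _) (integrable_inner_mul_inner hP _ _)]
      simp only [inner_add_left, mul_add])
    (fun c θ η => by
      rw [smul_eq_mul, ← integral_const_mul]
      simp only [real_inner_smul_left]
      congr 1; ext x; ring)

lemma gramForm_apply (hP : Integrable (fun x => ‖x‖ ^ 2) P) (θ η : EuclideanSpace ℝ (Fin d)) :
    gramForm P hP θ η = ∫ x, (inner ℝ θ x : ℝ) * inner ℝ η x ∂P := rfl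

lemma gramForm_self (hP : Integrable (fun x => ‖x‖ ^ 2) P) (θ : EuclideanSpace ℝ (Fin d)) :
    gramForm P hP θ θ = energy P θ := by
  rw [gramForm_apply, energy]
  simp only [sq]

lemma energy_nonneg (θ : EuclideanSpace ℝ (Fin d)) : 0 ≤ energy P θ :=
  integral_nonneg fun _ => sq_nonneg _

lemma energy_smul (c : ℝ) (θ : EuclideanSpace ℝ (Fin d)) :
    energy P (c • θ) = c ^ 2 * energy P θ := by
  simp only [energy, real_inner_smul_left, mul_pow, integral_const_mul]

lemma ae_inner_eq_zero (hP : Integrable (fun x => ‖x‖ ^ 2) P) {θ : EuclideanSpace ℝ (Fin d)}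
    (h : energy P θ = 0) : ∀ᵐ x ∂P, (inner ℝ θ x : ℝ) = 0 := by
  have hi : Integrable (fun x => (inner ℝ θ x : ℝ) ^ 2) P := by
    simpa only [sq] using integrable_inner_mul_inner hP θ θ
  have := (integral_eq_zero_iff_of_nonneg (fun x => sq_nonneg (inner ℝ θ x : ℝ)) hi).1 h
  filter_upwards [this] with x hx
  simpa using hx

/-- Coordinates in which the energy is the squared Euclidean norm, `X` having the coordinates
`⟨e i, X⟩` with `N(e i) ≤ 1`. They come from an orthogonal basis for the Gram form. The basis vectors of
zero energy are not discarded: `e i = 0` for them, thanks to `0⁻¹ = 0`, which is harmless as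
`⟨·, X⟩` vanishes almost surely on these vectors. -/
lemma exists_whitening (hP : Integrable (fun x => ‖x‖ ^ 2) P) :
    ∃ (e : Fin d → EuclideanSpace ℝ (Fin d))
      (c : EuclideanSpace ℝ (Fin d) → EuclideanSpace ℝ (Fin d)),
      (∀ i, energy P (e i) ≤ 1) ∧ (∀ θ, ‖c θ‖ ^ 2 = energy P θ) ∧
      ∀ᵐ x ∂P, ∀ θ, (inner ℝ θ x : ℝ) =
        inner ℝ (c θ) (WithLp.toLp 2 fun i => (inner ℝ (e i) x : ℝ)) := by
  have hsymm : LinearMap.IsSymm (gramForm P hP) := ⟨fun θ η => by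
    simp only [gramForm_apply, RingHom.id_apply]
    congr 1; ext x; ring⟩
  obtain ⟨v₀, hv₀⟩ := LinearMap.BilinForm.exists_orthogonal_basis hsymm
  have hfin : Module.finrank ℝ (EuclideanSpace ℝ (Fin d)) = d := finrank_euclideanSpace_fin
  set v := v₀.reindex (finCongr hfin) with hv
  have hort : ∀ i j, i ≠ j → gramForm P hP (v i) (v j) = 0 := by
    intro i j hij
    rw [hv, Module.Basis.reindex_apply, Module.Basis.reindex_apply]
    exact hv₀ (fun h => hij ((finCongr hfin).symm.injective h))
  set r : Fin d → ℝ := fun i => √(energy P (v i)) with hr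
  have hr2 (i : Fin d) : r i ^ 2 = energy P (v i) := Real.sq_sqrt (energy_nonneg _)
  refine ⟨fun i => (r i)⁻¹ • v i, fun θ => WithLp.toLp 2 fun i => r i * v.repr θ i, ?_, ?_, ?_⟩
  · intro i
    rw [energy_smul, ← hr2, ← mul_pow]
    by_cases h : r i = 0
    · simp [h]
    · simp [inv_mul_cancel₀ h]
  · intro θ
    rw [EuclideanSpace.real_norm_sq_eq, ← gramForm_self hP]
    have hθ := v.sum_repr θ
    conv_rhs => rw [← hθ]
    simp only [map_sum, LinearMap.sum_apply, map_smul, LinearMap.smul_apply, smul_eq_mul]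
    refine Finset.sum_congr rfl fun i _ => ?_
    rw [Finset.sum_eq_single i]
    · rw [gramForm_self, ← hr2]; ring
    · intro j _ hj
      rw [hort j i hj]; ring
    · simp
  · have h0 (i : Fin d) : ∀ᵐ x ∂P, r i = 0 → (inner ℝ (v i) x : ℝ) = 0 := by
      by_cases h : r i = 0
      · have := ae_inner_eq_zero hP (θ := v i) (by rw [← hr2, h]; ring)
        filter_upwards [this] with x hx _ using hx
      · exact Filter.Eventually.of_forall fun x hx => absurd hx h
    filter_upwards [ae_all_iff.2 h0] with x hx θ
    conv_lhs => rw [← v.sum_repr θ]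
    rw [sum_inner, PiLp.inner_apply]
    refine Finset.sum_congr rfl fun i _ => ?_
    simp only [real_inner_smul_left, RCLike.inner_apply, conj_trivial]
    by_cases h : r i = 0
    · rw [hx i h]; simp
    · field_simp

lemma integrable_inner_pow_four {κ : ℝ} (hκ : kurtosis P ≤ ENNReal.ofReal κ) (hκ0 : 0 ≤ κ)
    {θ : EuclideanSpace ℝ (Fin d)} (hθ : energy P θ ≤ 1) :
    Integrable (fun x => (inner ℝ θ x : ℝ) ^ 4) P ∧ ∫ x, (inner ℝ θ x : ℝ) ^ 4 ∂P ≤ κ := by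
  have h : ∫⁻ x, ENNReal.ofReal ((inner ℝ θ x : ℝ) ^ 4) ∂P ≤ ENNReal.ofReal κ :=
    (le_iSup₂ (f := fun (θ : EuclideanSpace ℝ (Fin d)) (_ : energy P θ ≤ 1) =>
      ∫⁻ x, ENNReal.ofReal (inner ℝ θ x ^ 4) ∂P) θ hθ).trans hκ
  have hnn (x : EuclideanSpace ℝ (Fin d)) : 0 ≤ (inner ℝ θ x : ℝ) ^ 4 := by positivity
  have hm : AEStronglyMeasurable (fun x => (inner ℝ θ x : ℝ) ^ 4) P := by fun_prop
  refine ⟨⟨hm, ?_⟩, ?_⟩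
  · rw [hasFiniteIntegral_iff_ofReal (Filter.Eventually.of_forall hnn)]
    exact h.trans_lt ENNReal.ofReal_lt_top
  · rw [integral_eq_lintegral_of_nonneg_ae (Filter.Eventually.of_forall hnn) hm]
    exact ENNReal.toReal_le_of_le_ofReal hκ0 h

lemma integrable_sq_mul_sq {κ : ℝ} (hκ : kurtosis P ≤ ENNReal.ofReal κ) (hκ0 : 0 ≤ κ)
    {θ η : EuclideanSpace ℝ (Fin d)} (hθ : energy P θ ≤ 1) (hη : energy P η ≤ 1) :
    Integrable (fun x => (inner ℝ θ x : ℝ) ^ 2 * (inner ℝ η x : ℝ) ^ 2) P ∧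
      ∫ x, (inner ℝ θ x : ℝ) ^ 2 * (inner ℝ η x : ℝ) ^ 2 ∂P ≤ κ := by
  obtain ⟨i1, h1⟩ := integrable_inner_pow_four hκ hκ0 hθ
  obtain ⟨i2, h2⟩ := integrable_inner_pow_four hκ hκ0 hη
  have i3 : Integrable
      (fun x => ((inner ℝ θ x : ℝ) ^ 4 + (inner ℝ η x : ℝ) ^ 4) / 2) P := (i1.add i2).div_const 2
  have hle (x : EuclideanSpace ℝ (Fin d)) : (inner ℝ θ x : ℝ) ^ 2 * (inner ℝ η x : ℝ) ^ 2 ≤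
      ((inner ℝ θ x : ℝ) ^ 4 + (inner ℝ η x : ℝ) ^ 4) / 2 := by
    nlinarith [sq_nonneg ((inner ℝ θ x : ℝ) ^ 2 - (inner ℝ η x : ℝ) ^ 2)]
  have i4 : Integrable (fun x => (inner ℝ θ x : ℝ) ^ 2 * (inner ℝ η x : ℝ) ^ 2) P :=
    i3.mono' (by fun_prop) (Filter.Eventually.of_forall fun x => by
      rw [Real.norm_eq_abs, abs_of_nonneg (by positivity)]; exact hle x)
  refine ⟨i4, (integral_mono i4 i3 hle).trans ?_⟩
  rw [integral_div, integral_add i1 i2]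
  linarith

/-- The mean over `X` of the bound of `integral_exp_surrogate_le`, where `m = α ⟨θ, X⟩` and
`s² = ∑ i, ⟨e i, X⟩² / β`. All moments of order four are controlled by the kurtosis. -/
lemma integral_expansion_le [IsProbabilityMeasure P] (hP : Integrable (fun x => ‖x‖ ^ 2) P)
    {κ : ℝ} (hκ : kurtosis P ≤ ENNReal.ofReal κ) (hκ0 : 0 ≤ κ)
    {e : Fin d → EuclideanSpace ℝ (Fin d)} (he : ∀ i, energy P (e i) ≤ 1)
    {θ : EuclideanSpace ℝ (Fin d)} (hθ : energy P θ = 1) (σ l α : ℝ) {β : ℝ} (hβ : 0 < β) :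
    Integrable (fun x => 1 + σ * l * ((α * inner ℝ θ x) ^ 2 - 1)
        + l ^ 2 / 2 * ((α * inner ℝ θ x) ^ 2 - 1) ^ 2
        + l ^ 2 * (46 * ((α * inner ℝ θ x) ^ 2 * ((∑ i, (inner ℝ (e i) x : ℝ) ^ 2) / β))
          + 67 * ((∑ i, (inner ℝ (e i) x : ℝ) ^ 2) / β) ^ 2)) P ∧
    ∫ x, (1 + σ * l * ((α * inner ℝ θ x) ^ 2 - 1)
        + l ^ 2 / 2 * ((α * inner ℝ θ x) ^ 2 - 1) ^ 2
        + l ^ 2 * (46 * ((α * inner ℝ θ x) ^ 2 * ((∑ i, (inner ℝ (e i) x : ℝ) ^ 2) / β))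
          + 67 * ((∑ i, (inner ℝ (e i) x : ℝ) ^ 2) / β) ^ 2)) ∂P ≤
      1 + σ * l * (α ^ 2 - 1) + l ^ 2 / 2 * (κ * (α ^ 2) ^ 2 - 2 * α ^ 2 + 1)
        + l ^ 2 * (46 * (α ^ 2 * κ * d / β) + 67 * (κ * d ^ 2 / β ^ 2)) := by
  obtain ⟨i4, h4⟩ := integrable_inner_pow_four hκ hκ0 hθ.le
  have i2 : Integrable (fun x => (inner ℝ θ x : ℝ) ^ 2) P := by
    simpa only [sq] using integrable_inner_mul_inner hP θ θ
  have h2 : ∫ x, (inner ℝ θ x : ℝ) ^ 2 ∂P = 1 := hθ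
  have im : Integrable (fun x => ∑ i, (inner ℝ θ x : ℝ) ^ 2 * (inner ℝ (e i) x : ℝ) ^ 2) P :=
    integrable_finsetSum _ fun i _ => (integrable_sq_mul_sq hκ hκ0 hθ.le (he i)).1
  have hm : ∫ x, ∑ i, (inner ℝ θ x : ℝ) ^ 2 * (inner ℝ (e i) x : ℝ) ^ 2 ∂P ≤ κ * d := by
    rw [integral_finsetSum _ fun i _ => (integrable_sq_mul_sq hκ hκ0 hθ.le (he i)).1]
    refine (Finset.sum_le_sum fun i _ => (integrable_sq_mul_sq hκ hκ0 hθ.le (he i)).2).trans ?_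
    simp [mul_comm]
  have iw : Integrable (fun x => ∑ i, ∑ j, (inner ℝ (e i) x : ℝ) ^ 2 * (inner ℝ (e j) x : ℝ) ^ 2) P :=
    integrable_finsetSum _ fun i _ => integrable_finsetSum _ fun j _ =>
      (integrable_sq_mul_sq hκ hκ0 (he i) (he j)).1
  have hw : ∫ x, ∑ i, ∑ j, (inner ℝ (e i) x : ℝ) ^ 2 * (inner ℝ (e j) x : ℝ) ^ 2 ∂P ≤ κ * d ^ 2 := by
    rw [integral_finsetSum _ fun i _ => integrable_finsetSum _ fun j _ =>
      (integrable_sq_mul_sq hκ hκ0 (he i) (he j)).1]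
    simp_rw [integral_finsetSum _ fun j _ => (integrable_sq_mul_sq hκ hκ0 (he _) (he j)).1]
    refine (Finset.sum_le_sum fun i _ => Finset.sum_le_sum fun j _ =>
      (integrable_sq_mul_sq hκ hκ0 (he i) (he j)).2).trans ?_
    simp
    apply le_of_eq; ring
  set A : ℝ := 1 - σ * l + l ^ 2 / 2 with hA
  set B : ℝ := σ * l * α ^ 2 - l ^ 2 * α ^ 2 with hB
  set C : ℝ := l ^ 2 / 2 * α ^ 4 with hC
  set D : ℝ := l ^ 2 * 46 * α ^ 2 / β with hD
  set E : ℝ := l ^ 2 * 67 / β ^ 2 with hE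
  have hfun : (fun x : EuclideanSpace ℝ (Fin d) => 1 + σ * l * ((α * inner ℝ θ x) ^ 2 - 1)
        + l ^ 2 / 2 * ((α * inner ℝ θ x) ^ 2 - 1) ^ 2
        + l ^ 2 * (46 * ((α * inner ℝ θ x) ^ 2 * ((∑ i, (inner ℝ (e i) x : ℝ) ^ 2) / β))
          + 67 * ((∑ i, (inner ℝ (e i) x : ℝ) ^ 2) / β) ^ 2)) =
      fun x => A + B * (inner ℝ θ x : ℝ) ^ 2 + C * (inner ℝ θ x : ℝ) ^ 4
        + D * (∑ i, (inner ℝ θ x : ℝ) ^ 2 * (inner ℝ (e i) x : ℝ) ^ 2)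
        + E * (∑ i, ∑ j, (inner ℝ (e i) x : ℝ) ^ 2 * (inner ℝ (e j) x : ℝ) ^ 2) := by
    funext x
    rw [← Finset.mul_sum, ← Finset.sum_mul_sum, hA, hB, hC, hD, hE]
    ring
  rw [hfun]
  have j1 : Integrable (fun x => A + B * (inner ℝ θ x : ℝ) ^ 2) P :=
    (integrable_const A).add (i2.const_mul B)
  have j2 : Integrable (fun x => A + B * (inner ℝ θ x : ℝ) ^ 2 + C * (inner ℝ θ x : ℝ) ^ 4) P :=
    j1.add (i4.const_mul C)
  have j3 : Integrable (fun x => A + B * (inner ℝ θ x : ℝ) ^ 2 + C * (inner ℝ θ x : ℝ) ^ 4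
      + D * (∑ i, (inner ℝ θ x : ℝ) ^ 2 * (inner ℝ (e i) x : ℝ) ^ 2)) P := j2.add (im.const_mul D)
  refine ⟨j3.add (iw.const_mul E), ?_⟩
  rw [integral_add j3 (iw.const_mul E), integral_add j2 (im.const_mul D),
    integral_add j1 (i4.const_mul C), integral_add (integrable_const A) (i2.const_mul B),
    integral_const_mul, integral_const_mul, integral_const_mul, integral_const_mul, h2]
  have hC0 : 0 ≤ C := by positivity
  have hD0 : 0 ≤ D := by positivity
  have hE0 : 0 ≤ E := by positivity
  calc _ ≤ A + B * 1 + C * κ + D * (κ * d) + E * (κ * d ^ 2) := by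
        simp only [integral_const, probReal_univ, one_smul]
        gcongr
    _ = _ := by rw [hA, hB, hC, hD, hE]; field_simp; ring

/-! ### A deviation inequality uniform in the direction -/

lemma stdGaussian_map_inner (y : EuclideanSpace ℝ (Fin d)) :
    (stdGaussian (EuclideanSpace ℝ (Fin d))).map (fun w => (inner ℝ w y : ℝ)) =
      (gaussianReal 0 1).map (fun g => ‖y‖ * g) := by
  have h := IsGaussian.map_eq_gaussianReal (μ := stdGaussian (EuclideanSpace ℝ (Fin d)))
    (innerSL ℝ y)
  rw [variance_dual_stdGaussian, integral_strongDual_stdGaussian] at h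
  rw [gaussianReal_map_const_mul]
  have h1 : (fun w : EuclideanSpace ℝ (Fin d) => (inner ℝ w y : ℝ)) = innerSL ℝ y := by
    funext w; rw [innerSL_apply_apply, real_inner_comm]
  rw [h1, h]
  congr 1
  · simp
  · ext; simp

lemma integral_comp_inner_stdGaussian {f : ℝ → ℝ} (hf : Measurable f)
    (y : EuclideanSpace ℝ (Fin d)) :
    ∫ w, f (inner ℝ w y) ∂(stdGaussian (EuclideanSpace ℝ (Fin d))) =
      ∫ g, f (‖y‖ * g) ∂(gaussianReal 0 1) := by
  have h1 := integral_map (μ := stdGaussian (EuclideanSpace ℝ (Fin d)))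
    (φ := fun w => (inner ℝ w y : ℝ)) (by fun_prop) (f := f) hf.aestronglyMeasurable
  have h2 := integral_map (μ := gaussianReal 0 1)
    (φ := fun g => ‖y‖ * g) (by fun_prop) (f := f) hf.aestronglyMeasurable
  rw [← h1, ← h2, stdGaussian_map_inner]

/-- The PAC-Bayes inequality applied to `surrogate` in whitened coordinates: the parameter `α θ` is
perturbed by a centred Gaussian vector whose inner product with `X` has variance `‖Y‖² / β`, where
`Y` is the whitened `X`. The relative entropy is `β α² / 2`. -/
theorem exists_event_sum_psi_lt [IsProbabilityMeasure P]
    (hP : Integrable (fun x => ‖x‖ ^ 2) P) {κ : ℝ} (hκ : kurtosis P ≤ ENNReal.ofReal κ)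
    (hκ0 : 0 ≤ κ) (n : ℕ) {σ : ℝ} (hσ : σ ^ 2 = 1) (l : ℝ) {β : ℝ} (hβ : 0 < β)
    {ε : ℝ} (hε : 0 < ε) :
    ∃ A : Set (Fin n → EuclideanSpace ℝ (Fin d)), MeasurableSet A ∧
      ENNReal.ofReal (1 - ε) ≤ Measure.pi (fun _ => P) A ∧
      ∀ x ∈ A, (∀ θ, energy P θ = 0 → ∀ i, (inner ℝ θ (x i) : ℝ) = 0) ∧
        ∀ θ, energy P θ = 1 → ∀ α : ℝ,
          ∑ i, psi (σ * l * ((inner ℝ (α • θ) (x i) : ℝ) ^ 2 - 1)) <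
            n * (σ * l * (α ^ 2 - 1) + l ^ 2 / 2 * (κ * (α ^ 2) ^ 2 - 2 * α ^ 2 + 1)
              + l ^ 2 * (46 * (α ^ 2 * κ * d / β) + 67 * (κ * d ^ 2 / β ^ 2)))
            + β * α ^ 2 / 2 + Real.log ε⁻¹ := by
  obtain ⟨e, c, he, hc, hec⟩ := exists_whitening hP
  set Y : EuclideanSpace ℝ (Fin d) → EuclideanSpace ℝ (Fin d) :=
    fun x => WithLp.toLp 2 fun i => (inner ℝ (e i) x : ℝ) with hY
  have hYm : Measurable Y := by
    rw [hY]; fun_prop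
  have hYnorm (x : EuclideanSpace ℝ (Fin d)) : ‖Y x‖ ^ 2 = ∑ i, (inner ℝ (e i) x : ℝ) ^ 2 := by
    rw [EuclideanSpace.real_norm_sq_eq]
  set r : ℝ := √β with hr
  have hr0 : 0 < r := Real.sqrt_pos.2 hβ
  have hr2 : r ^ 2 = β := Real.sq_sqrt hβ.le
  set H : EuclideanSpace ℝ (Fin d) → EuclideanSpace ℝ (Fin d) → ℝ :=
    fun w x => surrogate σ l (inner ℝ w (Y x) / r) (‖Y x‖ / r) with hH
  have hHm : Measurable (Function.uncurry H) := by
    have h1 : Measurable fun p : EuclideanSpace ℝ (Fin d) × EuclideanSpace ℝ (Fin d) =>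
        (inner ℝ p.1 (Y p.2) : ℝ) / r := by fun_prop
    have h2 : Measurable fun p : EuclideanSpace ℝ (Fin d) × EuclideanSpace ℝ (Fin d) =>
        ‖Y p.2‖ / r := by fun_prop
    exact measurable_surrogate σ l h1 h2
  have hHb (w x : EuclideanSpace ℝ (Fin d)) :
      |H w x| ≤ Real.log 2 + Real.log 5 + 2 * Real.log 4 := abs_surrogate_le _ _ _ _
  obtain ⟨A, hAm, hA, hAb⟩ := exists_event_pac_bayes P n hHm hHb hε
  obtain ⟨T, hTsub, hTm, hT⟩ := exists_measurable_superset_of_null (mem_ae_iff.1 hec)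
  have hgood (x : EuclideanSpace ℝ (Fin d)) (hx : x ∈ Tᶜ) (θ : EuclideanSpace ℝ (Fin d)) :
      (inner ℝ θ x : ℝ) = inner ℝ (c θ) (Y x) := by
    by_contra h
    exact hx (hTsub fun h' => h (h' θ))
  have hTn : (Measure.pi fun _ : Fin n => P) {x | ∀ i, x i ∈ Tᶜ}ᶜ = 0 := by
    rw [← mem_ae_iff, Filter.eventually_mem_set.symm]
    refine ae_all_iff.2 fun i => ?_
    have : ∀ᵐ y ∂P, y ∈ Tᶜ := by rw [ae_iff]; simpa using hT
    exact (measurePreserving_eval (fun _ : Fin n => P) i).quasiMeasurePreserving.ae this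
  refine ⟨A ∩ {x | ∀ i, x i ∈ Tᶜ}, hAm.inter ?_, ?_, ?_⟩
  · have : {x : Fin n → EuclideanSpace ℝ (Fin d) | ∀ i, x i ∈ Tᶜ} =
        ⋂ i, (fun x => x i) ⁻¹' Tᶜ := by ext x; simp
    rw [this]
    exact MeasurableSet.iInter fun i => measurable_pi_apply i hTm.compl
  · rwa [measure_inter_conull hTn]
  · rintro x ⟨hxA, hxT⟩
    refine ⟨fun θ hθ i => ?_, fun θ hθ α => ?_⟩
    · have : c θ = 0 := by
        have := hc θ
        rw [hθ] at this
        simpa using this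
      rw [hgood _ (hxT i), this, inner_zero_left]
    · have hpac := hAb x hxA ((r * α) • c θ)
      have hnorm : ‖(r * α) • c θ‖ ^ 2 = β * α ^ 2 := by
        rw [norm_smul, mul_pow, hc, hθ, Real.norm_eq_abs, sq_abs, mul_pow, hr2, mul_one]
      rw [hnorm] at hpac
      have hshift (w y : EuclideanSpace ℝ (Fin d)) (hy : y ∈ Tᶜ) :
          H (w + (r * α) • c θ) y = surrogate σ l
            (α * inner ℝ θ y + (inner ℝ w (Y y) : ℝ) / r) (‖Y y‖ / r) := by
        rw [hH]
        simp only
        rw [inner_add_left, real_inner_smul_left, ← hgood y hy]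
        congr 1
        field_simp
        ring
      have hmeas1 (m s : ℝ) : Measurable fun t : ℝ => surrogate σ l (m + t / r) s :=
        measurable_surrogate σ l (by fun_prop) measurable_const
      have hH1 (y : EuclideanSpace ℝ (Fin d)) (hy : y ∈ Tᶜ) :
          ∫ w, H (w + (r * α) • c θ) y ∂(stdGaussian _) = ∫ g, surrogate σ l
            (α * inner ℝ θ y + ‖Y y‖ / r * g) (‖Y y‖ / r) ∂(gaussianReal 0 1) := by
        simp_rw [hshift _ y hy]
        rw [integral_comp_inner_stdGaussian (hmeas1 _ _)]
        refine integral_congr_ae (Filter.Eventually.of_forall fun g => ?_)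
        simp only
        rw [mul_div_right_comm]
      have hH2 (y : EuclideanSpace ℝ (Fin d)) (hy : y ∈ Tᶜ) :
          ∫ w, Real.exp (H (w + (r * α) • c θ) y) ∂(stdGaussian _) =
            ∫ g, Real.exp (surrogate σ l
              (α * inner ℝ θ y + ‖Y y‖ / r * g) (‖Y y‖ / r)) ∂(gaussianReal 0 1) := by
        simp_rw [hshift _ y hy]
        rw [integral_comp_inner_stdGaussian (hmeas1 _ _).exp]
        refine integral_congr_ae (Filter.Eventually.of_forall fun g => ?_)
        simp only
        rw [mul_div_right_comm]
      have hlow : ∑ i, psi (σ * l * ((inner ℝ (α • θ) (x i) : ℝ) ^ 2 - 1)) ≤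
          ∑ i, ∫ w, H (w + (r * α) • c θ) (x i) ∂(stdGaussian _) := by
        refine Finset.sum_le_sum fun i _ => ?_
        rw [hH1 _ (hxT i), real_inner_smul_left]
        exact psi_le_integral_surrogate hσ l _ _
      obtain ⟨iG, hG⟩ := integral_expansion_le hP hκ hκ0 he hθ σ l α hβ
      have hprod : Integrable (Function.uncurry fun w y => Real.exp (H (w + (r * α) • c θ) y))
          ((stdGaussian (EuclideanSpace ℝ (Fin d))).prod P) := by
        refine integrable_of_abs_le
          (c := Real.exp (Real.log 2 + Real.log 5 + 2 * Real.log 4)) ?_ ?_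
        · have : Measurable fun p : EuclideanSpace ℝ (Fin d) × EuclideanSpace ℝ (Fin d) =>
              (p.1 + (r * α) • c θ, p.2) := by fun_prop
          exact (hHm.comp this).exp
        · intro p
          exact abs_exp_surrogate_le _ _ _ _
      have hup : ∫ w, ∫ y, Real.exp (H (w + (r * α) • c θ) y) ∂P
          ∂(stdGaussian (EuclideanSpace ℝ (Fin d))) ≤
          1 + σ * l * (α ^ 2 - 1) + l ^ 2 / 2 * (κ * (α ^ 2) ^ 2 - 2 * α ^ 2 + 1)
        + l ^ 2 * (46 * (α ^ 2 * κ * d / β) + 67 * (κ * d ^ 2 / β ^ 2)) := by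
        rw [integral_integral_swap hprod]
        refine (integral_mono_ae hprod.integral_prod_right iG ?_).trans hG
        have hTae : ∀ᵐ y ∂P, y ∈ Tᶜ := by rw [ae_iff]; simpa using hT
        filter_upwards [hTae] with y hy
        refine (hH2 y hy).trans_le ((integral_exp_surrogate_le hσ l _ _).trans (le_of_eq ?_))
        have e2 : (‖Y y‖ / r) ^ 2 = (∑ i, (inner ℝ (e i) y : ℝ) ^ 2) / β := by
          rw [div_pow, hr2, hYnorm]
        have e4 : (‖Y y‖ / r) ^ 4 = ((∑ i, (inner ℝ (e i) y : ℝ) ^ 2) / β) ^ 2 := by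
          rw [← e2]; ring
        rw [e2, e4]
      have hn : (0 : ℝ) ≤ n := Nat.cast_nonneg n
      have := mul_le_mul_of_nonneg_left hup hn
      linarith

/-! ### The numerical constants -/

lemma complexity_pos {d : ℕ} {ε : ℝ} (hε : 0 < ε) (hε1 : ε < 1) : 0 < complexity d ε := by
  have : 0 < Real.log ε⁻¹ := Real.log_pos ((one_lt_inv₀ hε).2 hε1)
  have : (0 : ℝ) ≤ 0.73 * d := by positivity
  unfold complexity
  linarith

lemma natCast_pos_of_threshold_lt {d n : ℕ} {κ ε : ℝ} (h : threshold d κ ε < n) : (0 : ℝ) < n :=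
  (sq_nonneg _).trans_lt h

lemma sq_scale {d n : ℕ} {κ ε : ℝ} (hκ : 1 < κ) (hL : 0 ≤ complexity d ε) :
    scale d n κ ε ^ 2 = 2 / ((κ - 1) * n) * complexity d ε := by
  have : 0 < κ - 1 := by linarith
  exact Real.sq_sqrt (by positivity)

/-- The first term of `mu` is `scale * (κ - 1)`: the scale balances the variance term and the
complexity term of the deviation bound. -/
lemma sqrt_eq_scale_mul {d n : ℕ} {κ ε : ℝ} (hκ : 1 < κ) :
    √(2 * (κ - 1) / n * complexity d ε) = scale d n κ ε * (κ - 1) := by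
  have h : 0 < κ - 1 := by linarith
  have e : 2 * (κ - 1) / n * complexity d ε
      = 2 / ((κ - 1) * n) * complexity d ε * (κ - 1) ^ 2 := by
    field_simp
  rw [scale, e, Real.sqrt_mul' _ (sq_nonneg _), Real.sqrt_sq h.le]

lemma mu_eq {d n : ℕ} {κ ε : ℝ} (hκ : 1 < κ) :
    mu d n κ ε = scale d n κ ε * (κ - 1) + 6.81 * √(2 * κ * d / n) := by
  rw [mu, sqrt_eq_scale_mul hκ]

lemma sqrt_two_mul_div (κ d n : ℝ) : √(2 * κ * d / n) = √2 * √(κ * d / n) := by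
  rw [← Real.sqrt_mul (by norm_num)]
  congr 1
  ring

/-- The condition on the sample size, divided by `√n`. -/
lemma weighted_sum_lt_one {d n : ℕ} {κ ε : ℝ} (hκ : 1 < κ) (h : threshold d κ ε < n) :
    20 * √(κ * d / n) + 5 / 2 * (scale d n κ ε * (κ - 1)) + scale d n κ ε / 2 < 1 := by
  have hn := natCast_pos_of_threshold_lt h
  have hκ1 : 0 < κ - 1 := by linarith
  have hsn : 0 < √(n : ℝ) := Real.sqrt_pos.2 hn
  have h1 : 20 * √(κ * d) + (5 / 2 + 1 / (2 * (κ - 1))) * √(2 * (κ - 1) * complexity d ε)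
      < √(n : ℝ) := Real.lt_sqrt_of_sq_lt h
  have h2 : √(κ * d) = √(κ * d / n) * √(n : ℝ) := by
    rw [← Real.sqrt_mul' _ hn.le]; congr 1; field_simp
  have h3 : √(2 * (κ - 1) * complexity d ε) = scale d n κ ε * (κ - 1) * √(n : ℝ) := by
    rw [← sqrt_eq_scale_mul hκ, ← Real.sqrt_mul' _ hn.le]; congr 1; field_simp
  rw [h2, h3] at h1
  have h4 : (20 * √(κ * d / n) + 5 / 2 * (scale d n κ ε * (κ - 1)) + scale d n κ ε / 2)
      * √(n : ℝ) < 1 * √(n : ℝ) := by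
    refine lt_of_eq_of_lt ?_ (h1.trans_eq (one_mul _).symm)
    field_simp
    ring
  exact lt_of_mul_lt_mul_right h4 hsn.le

lemma sqrt_two_lt : √2 < 1.4143 := by
  rw [Real.sqrt_lt' (by norm_num)]; norm_num

lemma weighted_mu_sum_lt_one {d n : ℕ} {κ ε : ℝ} (hκ : 1 < κ) (h : threshold d κ ε < n) :
    2 * (6.81 * √(2 * κ * d / n)) + 5 / 2 * (scale d n κ ε * (κ - 1)) + scale d n κ ε / 2 < 1 := by
  have := weighted_sum_lt_one hκ h
  rw [sqrt_two_mul_div]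
  have hq : 0 ≤ √(κ * d / n) := Real.sqrt_nonneg _
  nlinarith [sqrt_two_lt]

/-- The condition on the sample size bounds `mu` by `max (13.62 √2 / 20) (4 / 5) / 2 < 0.482`. -/
lemma one_sub_two_mul_mu_ge {d n : ℕ} {κ ε : ℝ} (hκ : 1 < κ) (h : threshold d κ ε < n) :
    0.03 ≤ 1 - 2 * mu d n κ ε := by
  have h1 := weighted_sum_lt_one hκ h
  have hκ1 : 0 < κ - 1 := by linarith
  have hl : 0 ≤ scale d n κ ε := Real.sqrt_nonneg _
  have hp : 0 ≤ scale d n κ ε * (κ - 1) := by positivity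
  have hq : 0 ≤ √(κ * d / n) := Real.sqrt_nonneg _
  rw [mu_eq hκ, sqrt_two_mul_div]
  nlinarith [sqrt_two_lt]

lemma mu_nonneg (d n : ℕ) (κ ε : ℝ) : 0 ≤ mu d n κ ε := by
  unfold mu; positivity

/-- The deviation bound for `-r (√a θ)` at `a = 1 + δ`, where `δ = μ / (1 - 2 μ)` is characterized by
`δ (1 - 2 μ) = μ`; the claim reduces to `(p + l) δ ≤ 2 μ`. -/
lemma drift_upper_nonpos {l k p R μ δ : ℝ} (hl : 0 ≤ l) (hk : 0 ≤ k) (hR : 0 ≤ R)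
    (hp : p = l * k) (hμ : μ = p + R) (h1 : 2 * R + 5 / 2 * p + l / 2 < 1)
    (hδ : δ = μ / (1 - 2 * μ)) :
    -δ + l / 2 * (k * (1 + δ) ^ 2 + δ ^ 2) + (1 + δ) * R + p / 2 ≤ 0 := by
  have hp0 : 0 ≤ p := hp ▸ mul_nonneg hl hk
  have h2 : 0 < 1 - 2 * μ := by rw [hμ]; linarith
  have hμ0 : 0 ≤ μ := by rw [hμ]; linarith
  have hδ0 : 0 ≤ δ := hδ ▸ div_nonneg hμ0 h2.le
  have hδμ : δ * (1 - 2 * μ) = μ := by rw [hδ, div_mul_cancel₀ _ h2.ne']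
  have h3 : δ * (2 * (1 - 2 * μ) - (p + l)) ≥ 0 := mul_nonneg hδ0 (by rw [hμ]; linarith)
  have h4 : δ * (2 * μ - (p + l) * δ) ≥ 0 := mul_nonneg hδ0 (by nlinarith)
  have e : -δ + l / 2 * (k * (1 + δ) ^ 2 + δ ^ 2) + (1 + δ) * R + p / 2 =
      (δ * (1 - 2 * μ) - μ) * (-1) - δ * (2 * μ - (p + l) * δ) / 2 := by
    rw [hμ, hp]; ring
  rw [e, hδμ]
  linarith

/-- The deviation bound for `r (√a θ)` at `a = 1 - δ`; the claim reduces to `l δ ≤ 4 μ`. -/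
lemma drift_lower_nonpos {l k p R μ δ : ℝ} (hl : 0 ≤ l) (hk : 0 ≤ k) (hR : 0 ≤ R)
    (hp : p = l * k) (hμ : μ = p + R) (h1 : 2 * R + 5 / 2 * p + l / 2 < 1)
    (hδ : δ = μ / (1 - 2 * μ)) (hδ1 : δ ≤ 1) :
    -δ + l / 2 * (k * (1 - δ) ^ 2 + δ ^ 2) + (1 - δ) * R + p / 2 ≤ 0 := by
  have hp0 : 0 ≤ p := hp ▸ mul_nonneg hl hk
  have h2 : 0 < 1 - 2 * μ := by rw [hμ]; linarith
  have hμ0 : 0 ≤ μ := by rw [hμ]; linarith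
  have hδ0 : 0 ≤ δ := hδ ▸ div_nonneg hμ0 h2.le
  have hδμ : δ * (1 - 2 * μ) = μ := by rw [hδ, div_mul_cancel₀ _ h2.ne']
  have h3 : δ * (4 * (1 - 2 * μ) - l) ≥ 0 := mul_nonneg hδ0 (by rw [hμ]; linarith)
  have h4 : δ * (4 * μ - l * δ) ≥ 0 := mul_nonneg hδ0 (by nlinarith)
  have h5 : (1 - δ) ^ 2 ≤ 1 := by nlinarith
  have h6 : p * (1 - δ) ^ 2 ≤ p := mul_le_of_le_one_right hp0 h5
  have h7 : (1 - δ) * R ≤ R := mul_le_of_le_one_left hR (by linarith)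
  have e : l / 2 * (k * (1 - δ) ^ 2 + δ ^ 2) = p * (1 - δ) ^ 2 / 2 + l * δ ^ 2 / 2 := by
    rw [hp]; ring
  rw [e]
  nlinarith

lemma mu_div_le {d n : ℕ} {κ ε : ℝ} (hκ : 1 < κ)
    (hL : 0 ≤ Real.log ε⁻¹ + 0.73 * d) (h : threshold d κ ε < n) :
    mu d n κ ε / (1 - 2 * mu d n κ ε) ≤ 1000 * √(κ * (d + Real.log ε⁻¹) / n) := by
  have hn := natCast_pos_of_threshold_lt h
  have hd : (0 : ℝ) ≤ d := Nat.cast_nonneg d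
  have hκ1 : 0 < κ - 1 := by linarith
  set D := d + Real.log ε⁻¹ with hD
  have hLD : complexity d ε ≤ D := by unfold complexity; rw [hD]; linarith
  have hdD : 0.27 * d ≤ D := by rw [hD]; linarith
  have hD0 : 0 ≤ D := le_trans (by positivity) hdD
  have hq : 0 ≤ √(κ * D / n) := Real.sqrt_nonneg _
  have h1 : √(2 * (κ - 1) / n * complexity d ε) ≤ 2 * √(κ * D / n) := by
    rw [show (2 : ℝ) = √(2 ^ 2) by rw [Real.sqrt_sq (by norm_num)], ← Real.sqrt_mul (by norm_num)]
    refine Real.sqrt_le_sqrt ?_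
    rw [Real.sqrt_sq (by norm_num), div_mul_eq_mul_div, mul_div_assoc',
      div_le_div_iff_of_pos_right hn]
    have : (κ - 1) * complexity d ε ≤ κ * D :=
      mul_le_mul (by linarith) hLD hL (by linarith)
    have : 0 ≤ κ * D := by positivity
    nlinarith
  have h2 : √(2 * κ * d / n) ≤ 3 * √(κ * D / n) := by
    rw [show (3 : ℝ) = √(3 ^ 2) by rw [Real.sqrt_sq (by norm_num)], ← Real.sqrt_mul (by norm_num)]
    refine Real.sqrt_le_sqrt ?_
    rw [mul_div_assoc', div_le_div_iff_of_pos_right hn]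
    nlinarith
  have hmu : mu d n κ ε ≤ 30 * √(κ * D / n) := by
    unfold mu; linarith
  have h3 := one_sub_two_mul_mu_ge hκ h
  rw [div_le_iff₀ (by linarith)]
  nlinarith

lemma threshold_le {κ₀ : ℝ} (hκ₀ : 1 < κ₀) {d : ℕ} {κ ε : ℝ} (hκ : κ₀ ≤ κ)
    (hL : 0 ≤ Real.log ε⁻¹ + 0.73 * d) :
    threshold d κ ε ≤ (40 + (5 / 2 + 1 / (2 * (κ₀ - 1))) * 2) ^ 2 *
      (κ * (d + Real.log ε⁻¹)) := by
  have hd : (0 : ℝ) ≤ d := Nat.cast_nonneg d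
  have hκ1 : 0 < κ₀ - 1 := by linarith
  set D := d + Real.log ε⁻¹ with hD
  have hLD : complexity d ε ≤ D := by unfold complexity; rw [hD]; linarith
  have hdD : 0.27 * d ≤ D := by rw [hD]; linarith
  have hD0 : 0 ≤ D := le_trans (by positivity) hdD
  have hκD : 0 ≤ κ * D := mul_nonneg (by linarith) hD0
  have h1 : √(κ * d) ≤ 2 * √(κ * D) := by
    rw [show (2 : ℝ) = √(2 ^ 2) by rw [Real.sqrt_sq (by norm_num)], ← Real.sqrt_mul (by norm_num)]
    exact Real.sqrt_le_sqrt (by nlinarith)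
  have h2 : √(2 * (κ - 1) * complexity d ε) ≤ 2 * √(κ * D) := by
    have e : 2 * √(κ * D) = √(2 ^ 2 * (κ * D)) := by
      rw [Real.sqrt_mul (show (0 : ℝ) ≤ 2 ^ 2 by norm_num), Real.sqrt_sq (by norm_num)]
    rw [e]
    refine Real.sqrt_le_sqrt ?_
    have : (κ - 1) * complexity d ε ≤ κ * D :=
      mul_le_mul (by linarith) hLD hL (by linarith)
    nlinarith
  have h3 : 1 / (2 * (κ - 1)) ≤ 1 / (2 * (κ₀ - 1)) :=
    one_div_le_one_div_of_le (by linarith) (by linarith)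
  have h4 : 0 ≤ 1 / (2 * (κ - 1)) := one_div_nonneg.2 (by linarith)
  have h5 : (5 / 2 + 1 / (2 * (κ - 1))) * √(2 * (κ - 1) * complexity d ε) ≤
      (5 / 2 + 1 / (2 * (κ₀ - 1))) * (2 * √(κ * D)) :=
    mul_le_mul (by linarith) h2 (Real.sqrt_nonneg _) (by linarith)
  calc threshold d κ ε ≤ ((40 + (5 / 2 + 1 / (2 * (κ₀ - 1))) * 2) * √(κ * D)) ^ 2 := by
        unfold threshold
        refine pow_le_pow_left₀ (by positivity) ?_ 2
        linarith
    _ = _ := by rw [mul_pow, Real.sq_sqrt hκD]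

/-! ### From the criterion to the relative error -/

variable {n : ℕ}

lemma criterion_nonpos_of_inner_eq_zero {l : ℝ} (hl : 0 ≤ l)
    {x : Fin n → EuclideanSpace ℝ (Fin d)} {θ : EuclideanSpace ℝ (Fin d)}
    (h : ∀ i, (inner ℝ θ (x i) : ℝ) = 0) : criterion l x θ ≤ 0 := by
  unfold criterion
  refine mul_nonpos_of_nonneg_of_nonpos (inv_nonneg.2 hl)
    (mul_nonpos_of_nonneg_of_nonpos (by positivity) (Finset.sum_nonpos fun i _ => ?_))
  rw [h i]
  exact psi_nonpos (by nlinarith)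

lemma alphaHat_eq_top {l : ℝ} (hl : 0 ≤ l)
    {x : Fin n → EuclideanSpace ℝ (Fin d)} {θ : EuclideanSpace ℝ (Fin d)}
    (h : ∀ i, (inner ℝ θ (x i) : ℝ) = 0) : alphaHat l x θ = ∞ := by
  refine ENNReal.eq_top_of_forall_nnreal_le fun r => ?_
  refine le_iSup₂ (f := fun (α : ℝ≥0) (_ : criterion l x ((α : ℝ) • θ) ≤ 0) => (α : ℝ≥0∞)) r ?_
  exact criterion_nonpos_of_inner_eq_zero hl fun i => by rw [real_inner_smul_left, h i, mul_zero]

/-- In a direction of zero energy both the energy and its estimator vanish, and `0 / 0 = 1`. -/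
lemma relError_eq_zero {l : ℝ} (hl : 0 ≤ l)
    {x : Fin n → EuclideanSpace ℝ (Fin d)} {θ : EuclideanSpace ℝ (Fin d)}
    (hθ : energy P θ = 0) (h : ∀ i, (inner ℝ θ (x i) : ℝ) = 0) : relError P l x θ = 0 := by
  have h1 : energyHat l x θ = 0 := by simp [energyHat, alphaHat_eq_top hl h]
  rw [relError, h1, hθ, ratio, if_pos (by simp)]
  exact EReal.sub_self (by decide) (by decide)

lemma relError_of_pos (l : ℝ) (x : Fin n → EuclideanSpace ℝ (Fin d))
    {θ : EuclideanSpace ℝ (Fin d)} (hθ : 0 < energy P θ) :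
    relError P l x θ = ((ENNReal.ofReal (energy P θ) * alphaHat l x θ ^ 2 : ℝ≥0∞) : EReal) - 1 := by
  rw [relError, ratio, if_neg (fun h => by simp at h; linarith), energyHat, div_eq_mul_inv, inv_inv]

lemma criterion_smul_mono {l : ℝ} (hl : 0 ≤ l) (x : Fin n → EuclideanSpace ℝ (Fin d))
    (θ : EuclideanSpace ℝ (Fin d)) {a b : ℝ} (hab : a ^ 2 ≤ b ^ 2) :
    criterion l x (a • θ) ≤ criterion l x (b • θ) := by
  unfold criterion
  refine mul_le_mul_of_nonneg_left (mul_le_mul_of_nonneg_left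
    (Finset.sum_le_sum fun i _ => psi_mono ?_) (by positivity)) (inv_nonneg.2 hl)
  simp only [real_inner_smul_left, mul_pow]
  gcongr

/-- As the criterion is nondecreasing along rays, its sign at a single point of each ray bounds
`alphaHat` from above. -/
lemma relError_le_of_criterion_pos {l δ : ℝ} (hl : 0 ≤ l) (hδ : 0 ≤ δ)
    {x : Fin n → EuclideanSpace ℝ (Fin d)}
    (h0 : ∀ θ, energy P θ = 0 → ∀ i, (inner ℝ θ (x i) : ℝ) = 0)
    (h1 : ∀ θ, energy P θ = 1 → 0 < criterion l x (√(1 + δ) • θ))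
    (θ : EuclideanSpace ℝ (Fin d)) : relError P l x θ ≤ (δ : EReal) := by
  rcases (energy_nonneg (P := P) θ).eq_or_lt with hv | hv
  · rw [relError_eq_zero hl hv.symm (h0 θ hv.symm)]
    exact_mod_cast hδ
  · rw [relError_of_pos l x hv]
    set v := energy P θ with hvdef
    have hs : 0 < √v := Real.sqrt_pos.2 hv
    have hs2 : √v ^ 2 = v := Real.sq_sqrt hv.le
    have hunit : energy P ((√v)⁻¹ • θ) = 1 := by
      rw [energy_smul, inv_pow, hs2, inv_mul_cancel₀ hv.ne']
    have hα : alphaHat l x θ ≤ ENNReal.ofReal (√((1 + δ) / v)) := by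
      refine iSup₂_le fun α hα => ?_
      rw [← ENNReal.ofReal_coe_nnreal]
      refine ENNReal.ofReal_le_ofReal ?_
      by_contra! hlt
      have hlt2 : (1 + δ) / v < (α : ℝ) ^ 2 :=
        (Real.sqrt_lt' (lt_of_le_of_lt (Real.sqrt_nonneg _) hlt)).1 hlt
      have hpos := h1 _ hunit
      rw [smul_smul] at hpos
      have := criterion_smul_mono hl x θ (a := √(1 + δ) * (√v)⁻¹) (b := α) (by
        rw [mul_pow, inv_pow, hs2, Real.sq_sqrt (by linarith), ← div_eq_mul_inv]
        exact hlt2.le)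
      linarith
    have h2 : ENNReal.ofReal v * alphaHat l x θ ^ 2 ≤ ENNReal.ofReal (1 + δ) := by
      calc _ ≤ ENNReal.ofReal v * ENNReal.ofReal (√((1 + δ) / v)) ^ 2 := by gcongr
        _ = ENNReal.ofReal (1 + δ) := by
          rw [← ENNReal.ofReal_pow (Real.sqrt_nonneg _), ← ENNReal.ofReal_mul hv.le,
            Real.sq_sqrt (by positivity)]
          congr 1
          field_simp
    have h3 : ((ENNReal.ofReal v * alphaHat l x θ ^ 2 : ℝ≥0∞) : EReal) ≤ ((1 + δ : ℝ) : EReal) := by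
      refine (EReal.coe_ennreal_le_coe_ennreal_iff.2 h2).trans (le_of_eq ?_)
      rw [EReal.coe_ennreal_ofReal, max_eq_left (by linarith)]
    refine (EReal.sub_le_sub h3 le_rfl).trans (le_of_eq ?_)
    rw [← EReal.coe_one, ← EReal.coe_sub]
    congr 1
    ring

lemma neg_le_relError_of_criterion_nonpos {l δ : ℝ} (hl : 0 ≤ l) (hδ : 0 ≤ δ)
    {x : Fin n → EuclideanSpace ℝ (Fin d)}
    (h0 : ∀ θ, energy P θ = 0 → ∀ i, (inner ℝ θ (x i) : ℝ) = 0)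
    (h1 : δ ≤ 1 → ∀ θ, energy P θ = 1 → criterion l x (√(1 - δ) • θ) ≤ 0)
    (θ : EuclideanSpace ℝ (Fin d)) : ((-δ : ℝ) : EReal) ≤ relError P l x θ := by
  rcases (energy_nonneg (P := P) θ).eq_or_lt with hv | hv
  · rw [relError_eq_zero hl hv.symm (h0 θ hv.symm)]
    exact_mod_cast neg_nonpos.2 hδ
  · rw [relError_of_pos l x hv]
    set v := energy P θ with hvdef
    have h2 : ENNReal.ofReal (1 - δ) ≤ ENNReal.ofReal v * alphaHat l x θ ^ 2 := by
      rcases le_or_gt δ 1 with hδ1 | hδ1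
      · have hs : 0 < √v := Real.sqrt_pos.2 hv
        have hs2 : √v ^ 2 = v := Real.sq_sqrt hv.le
        have hunit : energy P ((√v)⁻¹ • θ) = 1 := by
          rw [energy_smul, inv_pow, hs2, inv_mul_cancel₀ hv.ne']
        have hc := h1 hδ1 _ hunit
        rw [smul_smul] at hc
        have hnn : 0 ≤ √(1 - δ) * (√v)⁻¹ := by positivity
        have hα : ENNReal.ofReal (√(1 - δ) * (√v)⁻¹) ≤ alphaHat l x θ :=
          le_iSup₂ (f := fun (α : ℝ≥0) (_ : criterion l x ((α : ℝ) • θ) ≤ 0) => (α : ℝ≥0∞))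
            (Real.toNNReal (√(1 - δ) * (√v)⁻¹)) (by rwa [Real.coe_toNNReal _ hnn])
        calc ENNReal.ofReal (1 - δ)
            = ENNReal.ofReal v * ENNReal.ofReal (√(1 - δ) * (√v)⁻¹) ^ 2 := by
              rw [← ENNReal.ofReal_pow hnn, ← ENNReal.ofReal_mul hv.le, mul_pow, inv_pow, hs2,
                Real.sq_sqrt (by linarith)]
              congr 1
              field_simp
          _ ≤ _ := by gcongr
      · rw [ENNReal.ofReal_of_nonpos (by linarith)]
        exact bot_le
    have h3 : ((1 - δ : ℝ) : EReal) ≤ ((ENNReal.ofReal v * alphaHat l x θ ^ 2 : ℝ≥0∞) : EReal) := by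
      refine le_trans ?_ (EReal.coe_ennreal_le_coe_ennreal_iff.2 h2)
      rw [EReal.coe_ennreal_ofReal]
      exact EReal.coe_le_coe_iff.2 (le_max_left _ _)
    refine le_trans (le_of_eq ?_) (EReal.sub_le_sub h3 le_rfl)
    rw [← EReal.coe_one, ← EReal.coe_sub]
    congr 1
    ring

lemma abs_le_ofReal {z : EReal} {δ : ℝ} (h1 : ((-δ : ℝ) : EReal) ≤ z) (h2 : z ≤ (δ : EReal)) :
    z.abs ≤ ENNReal.ofReal δ := by
  induction z with
  | bot => simp at h1
  | top => simp at h2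
  | coe r =>
    rw [EReal.abs_def]
    exact ENNReal.ofReal_le_ofReal
      (abs_le.2 ⟨EReal.coe_le_coe_iff.1 h1, EReal.coe_le_coe_iff.1 h2⟩)

/-! ### Probability bounds for the relative error -/

lemma ProbAtLeast.of_nonpos {Ω : Type*} [MeasurableSpace Ω] (Pr : Measure Ω) {p : ℝ} (hp : p ≤ 0)
    (A : Set Ω) : ProbAtLeast Pr p A :=
  ⟨∅, MeasurableSet.empty, Set.empty_subset _, by simp [ENNReal.ofReal_of_nonpos hp]⟩

lemma ProbAtLeast.inter {Ω : Type*} [MeasurableSpace Ω] {Pr : Measure Ω} [IsProbabilityMeasure Pr]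
    {p q : ℝ} {A B : Set Ω} (hA : ProbAtLeast Pr (1 - p) A) (hB : ProbAtLeast Pr (1 - q) B) :
    ProbAtLeast Pr (1 - (p + q)) (A ∩ B) := by
  obtain ⟨S, hS, hSA, hp⟩ := hA
  obtain ⟨T, hT, hTB, hq⟩ := hB
  refine ⟨S ∩ T, hS.inter hT, Set.inter_subset_inter hSA hTB, ENNReal.ofReal_le_of_le_toReal ?_⟩
  have h1 : 1 - p ≤ Pr.real S := (ENNReal.ofReal_le_iff_le_toReal (measure_ne_top _ _)).1 hp
  have h2 : 1 - q ≤ Pr.real T := (ENNReal.ofReal_le_iff_le_toReal (measure_ne_top _ _)).1 hq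
  have h3 := measureReal_union_add_inter (μ := Pr) (s := S) (t := T) hT
  have h4 : Pr.real (S ∪ T) ≤ 1 := measureReal_le_one
  change 1 - (p + q) ≤ Pr.real (S ∩ T)
  linarith

/-- An event on the sample space transfers to the underlying probability space, although the sample
is only almost everywhere measurable. -/
lemma ProbAtLeast.of_pi {Ω S : Type*} [MeasurableSpace Ω] [MeasurableSpace S] {Pr : Measure Ω}
    [IsProbabilityMeasure Pr] {P : Measure S} {X : Fin n → Ω → S}
    (hX : ∀ i, HasLaw (X i) P Pr) (hind : iIndepFun X Pr) {A : Set (Fin n → S)}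
    (hA : MeasurableSet A) {p : ℝ} (hp : ENNReal.ofReal p ≤ Measure.pi (fun _ => P) A)
    {E : Set (Fin n → S)} (hE : A ⊆ E) : ProbAtLeast Pr p {ω | (fun i => X i ω) ∈ E} := by
  have hm : AEMeasurable (fun ω i => X i ω) Pr := aemeasurable_pi_lambda _ fun i => (hX i).aemeasurable
  have hlaw : Pr.map (fun ω i => X i ω) = Measure.pi fun _ => P := by
    rw [(iIndepFun_iff_map_fun_eq_pi_map fun i => (hX i).aemeasurable).1 hind]
    congr 1
    funext i
    exact (hX i).map_eq
  obtain ⟨B, hBA, hB, hBeq⟩ := (hm.nullMeasurable hA).exists_measurable_subset_ae_eq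
  refine ⟨B, hB, fun ω hω => hE (hBA hω), ?_⟩
  rw [measure_congr hBeq, ← Measure.map_apply_of_aemeasurable hm hA, hlaw]
  exact hp

/-- The deviation bound with the precision `β = l √(92 n κ d)` of the perturbation, which equates the
entropy term `β a / (2 n l)` and the cross term `46 l a κ d / β`. Their sum is `a √(92 κ d / n)`, and
`92 < 2 * 6.81²`. The last term `67 l κ d² / β² = (67 / 92) d / (n l)` is absorbed by the summand
`0.73 d` of the complexity. -/
theorem exists_event_drift [IsProbabilityMeasure P]
    (hP : Integrable (fun x => ‖x‖ ^ 2) P) {κ ε : ℝ} (hκ1 : 1 < κ)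
    (hκ : kurtosis P ≤ ENNReal.ofReal κ) (hε : 0 < ε) (hε1 : ε < 1) (hn : (0 : ℝ) < n)
    {σ : ℝ} (hσ : σ ^ 2 = 1) :
    ∃ A : Set (Fin n → EuclideanSpace ℝ (Fin d)), MeasurableSet A ∧
      ENNReal.ofReal (1 - ε) ≤ Measure.pi (fun _ => P) A ∧
      ∀ x ∈ A, (∀ θ, energy P θ = 0 → ∀ i, (inner ℝ θ (x i) : ℝ) = 0) ∧
        ∀ θ, energy P θ = 1 → ∀ a : ℝ, 0 ≤ a →
          ∑ i, psi (σ * scale d n κ ε * ((inner ℝ (√a • θ) (x i) : ℝ) ^ 2 - 1)) <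
            n * scale d n κ ε * (σ * (a - 1)
              + scale d n κ ε / 2 * ((κ - 1) * a ^ 2 + (a - 1) ^ 2)
              + a * (6.81 * √(2 * κ * d / n)) + scale d n κ ε * (κ - 1) / 2) := by
  have hL := complexity_pos (d := d) hε hε1
  have hκ0 : 0 < κ - 1 := by linarith
  have hl2 := sq_scale (n := n) hκ1 hL.le
  have hl : 0 < scale d n κ ε := Real.sqrt_pos.2 (by positivity)
  set l := scale d n κ ε with hldef
  rcases Nat.eq_zero_or_pos d with rfl | hd
  · obtain ⟨A, hAm, hA, h⟩ := exists_event_sum_psi_lt hP hκ (by linarith) n hσ l one_pos hε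
    refine ⟨A, hAm, hA, fun x hx => ⟨(h x hx).1, fun θ hθ => ?_⟩⟩
    -- in dimension zero there is no vector of energy one
    have : θ = 0 := Subsingleton.elim _ _
    simp [this, energy] at hθ
  · have hd' : (0 : ℝ) < d := Nat.cast_pos.2 hd
    set s := √(92 * n * κ * d) with hs
    have hs0 : 0 < s := Real.sqrt_pos.2 (by positivity)
    have hs2 : s ^ 2 = 92 * n * κ * d := Real.sq_sqrt (by positivity)
    obtain ⟨A, hAm, hA, h⟩ := exists_event_sum_psi_lt hP hκ (by linarith) n hσ l
      (mul_pos hl hs0) hε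
    refine ⟨A, hAm, hA, fun x hx => ⟨(h x hx).1, fun θ hθ a ha => ((h x hx).2 θ hθ √a).trans_le ?_⟩⟩
    rw [Real.sq_sqrt ha]
    have hR : s ≤ n * (6.81 * √(2 * κ * d / n)) := by
      have hq : √(2 * κ * d / n) ^ 2 = 2 * κ * d / n := Real.sq_sqrt (by positivity)
      refine (abs_le_of_sq_le_sq' ?_ (by positivity)).2
      rw [mul_pow, mul_pow, hq, hs2]
      have : (n : ℝ) ^ 2 * (6.81 ^ 2 * (2 * κ * d / n)) = 6.81 ^ 2 * 2 * (n * κ * d) := by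
        field_simp
      rw [this]
      have : 0 < n * κ * d := by positivity
      nlinarith
    have hLl : complexity d ε = n * l * (l * (κ - 1) / 2) := by
      have : n * l * (l * (κ - 1) / 2) = l ^ 2 * (n * (κ - 1) / 2) := by ring
      rw [this, hl2]
      field_simp
    have e1 : (n : ℝ) * (l ^ 2 * (46 * (a * κ * d / (l * s)))) = l * a * s / 2 := by
      have : (n : ℝ) * (l ^ 2 * (46 * (a * κ * d / (l * s)))) = l * a * (92 * n * κ * d) / (2 * s) := by
        field_simp
        ring
      rw [this, ← hs2]
      field_simp
    have e2 : (n : ℝ) * (l ^ 2 * (67 * (κ * d ^ 2 / (l * s) ^ 2))) = 67 / 92 * d := by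
      rw [mul_pow, hs2]
      field_simp
    have hlog : Real.log ε⁻¹ = complexity d ε - 0.73 * d := by unfold complexity; ring
    have h3 : l * a * s ≤ l * a * (n * (6.81 * √(2 * κ * d / n))) :=
      mul_le_mul_of_nonneg_left hR (by positivity)
    calc _ = n * l * (σ * (a - 1)) + n * (l ^ 2 / 2 * (κ * a ^ 2 - 2 * a + 1))
          + (n * (l ^ 2 * (46 * (a * κ * d / (l * s))))
            + n * (l ^ 2 * (67 * (κ * d ^ 2 / (l * s) ^ 2)))) + l * s * a / 2 + Real.log ε⁻¹ := by
          ring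
      _ = n * l * (σ * (a - 1)) + n * (l ^ 2 / 2 * (κ * a ^ 2 - 2 * a + 1))
          + l * a * s + n * l * (l * (κ - 1) / 2) + (67 / 92 - 0.73) * d := by
          rw [e1, e2, hlog, hLl]; ring
      _ ≤ n * l * (σ * (a - 1)) + n * (l ^ 2 / 2 * (κ * a ^ 2 - 2 * a + 1))
          + l * a * (n * (6.81 * √(2 * κ * d / n))) + n * l * (l * (κ - 1) / 2) := by
          nlinarith
      _ = _ := by ring

lemma criterion_pos_of_sum {l : ℝ} (hl : 0 < l) (hn : (0 : ℝ) < n)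
    {x : Fin n → EuclideanSpace ℝ (Fin d)} {θ : EuclideanSpace ℝ (Fin d)}
    (h : ∑ i, psi (-1 * l * ((inner ℝ θ (x i) : ℝ) ^ 2 - 1)) < 0) : 0 < criterion l x θ := by
  have h1 : ∑ i, psi (l * ((inner ℝ θ (x i) : ℝ) ^ 2 - 1)) =
      -∑ i, psi (-1 * l * ((inner ℝ θ (x i) : ℝ) ^ 2 - 1)) := by
    rw [← Finset.sum_neg_distrib]
    refine Finset.sum_congr rfl fun i _ => ?_
    rw [← psi_neg]
    congr 1
    ring
  rw [criterion, h1]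
  have : 0 < -∑ i, psi (-1 * l * ((inner ℝ θ (x i) : ℝ) ^ 2 - 1)) := by linarith
  positivity

section
variable {Ω : Type*} [MeasurableSpace Ω] {Pr : Measure Ω} [IsProbabilityMeasure Pr]
  [IsProbabilityMeasure P] {X : Fin n → Ω → EuclideanSpace ℝ (Fin d)} {κ ε : ℝ}

theorem probAtLeast_relError_le
    (hX : ∀ i, HasLaw (X i) P Pr) (hind : iIndepFun X Pr)
    (hP : Integrable (fun x => ‖x‖ ^ 2) P) (hκ1 : 1 < κ)
    (hκ : kurtosis P ≤ ENNReal.ofReal κ) (hε : 0 < ε) (hT : threshold d κ ε < n) :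
    ProbAtLeast Pr (1 - ε) {ω | ∀ θ : EuclideanSpace ℝ (Fin d),
      relError P (scale d n κ ε) (fun i => X i ω) θ ≤
        ((mu d n κ ε / (1 - 2 * mu d n κ ε) : ℝ) : EReal)} := by
  rcases le_or_gt 1 ε with hε1 | hε1
  · exact ProbAtLeast.of_nonpos Pr (by linarith) _
  have hn := natCast_pos_of_threshold_lt hT
  have hL := complexity_pos (d := d) hε hε1
  have hκ0 : 0 < κ - 1 := by linarith
  have hl : 0 < scale d n κ ε := Real.sqrt_pos.2 (by positivity)
  have hμ := one_sub_two_mul_mu_ge hκ1 hT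
  have hδ : 0 ≤ mu d n κ ε / (1 - 2 * mu d n κ ε) := div_nonneg (mu_nonneg _ _ _ _) (by linarith)
  obtain ⟨A, hAm, hA, h⟩ := exists_event_drift hP hκ1 hκ hε hε1 hn (σ := -1) (by norm_num)
  refine ProbAtLeast.of_pi hX hind hAm hA (E := {x | ∀ θ : EuclideanSpace ℝ (Fin d),
    relError P (scale d n κ ε) x θ ≤ ((mu d n κ ε / (1 - 2 * mu d n κ ε) : ℝ) : EReal)})
    fun x hx => ?_
  refine relError_le_of_criterion_pos hl.le hδ (h x hx).1 fun θ hθ => ?_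
  refine criterion_pos_of_sum hl hn (((h x hx).2 θ hθ _ (by linarith)).trans_le ?_)
  refine mul_nonpos_of_nonneg_of_nonpos (by positivity) ?_
  have := drift_upper_nonpos hl.le hκ0.le (R := 6.81 * √(2 * κ * d / n)) (by positivity) rfl
    (mu_eq hκ1) (weighted_mu_sum_lt_one hκ1 hT) rfl
  refine le_trans (le_of_eq ?_) this
  ring

theorem probAtLeast_neg_le_relError
    (hX : ∀ i, HasLaw (X i) P Pr) (hind : iIndepFun X Pr)
    (hP : Integrable (fun x => ‖x‖ ^ 2) P) (hκ1 : 1 < κ)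
    (hκ : kurtosis P ≤ ENNReal.ofReal κ) (hε : 0 < ε) (hT : threshold d κ ε < n) :
    ProbAtLeast Pr (1 - ε) {ω | ∀ θ : EuclideanSpace ℝ (Fin d),
      ((-(mu d n κ ε / (1 - 2 * mu d n κ ε)) : ℝ) : EReal) ≤
        relError P (scale d n κ ε) (fun i => X i ω) θ} := by
  rcases le_or_gt 1 ε with hε1 | hε1
  · exact ProbAtLeast.of_nonpos Pr (by linarith) _
  have hn := natCast_pos_of_threshold_lt hT
  have hL := complexity_pos (d := d) hε hε1
  have hκ0 : 0 < κ - 1 := by linarith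
  have hl : 0 < scale d n κ ε := Real.sqrt_pos.2 (by positivity)
  have hμ := one_sub_two_mul_mu_ge hκ1 hT
  have hδ : 0 ≤ mu d n κ ε / (1 - 2 * mu d n κ ε) := div_nonneg (mu_nonneg _ _ _ _) (by linarith)
  obtain ⟨A, hAm, hA, h⟩ := exists_event_drift hP hκ1 hκ hε hε1 hn (σ := 1) (by norm_num)
  refine ProbAtLeast.of_pi hX hind hAm hA (E := {x | ∀ θ : EuclideanSpace ℝ (Fin d),
    ((-(mu d n κ ε / (1 - 2 * mu d n κ ε)) : ℝ) : EReal) ≤ relError P (scale d n κ ε) x θ})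
    fun x hx => ?_
  refine neg_le_relError_of_criterion_nonpos hl.le hδ (h x hx).1 fun hδ1 θ hθ => ?_
  have hdrift := drift_lower_nonpos hl.le hκ0.le (R := 6.81 * √(2 * κ * d / n)) (by positivity) rfl
    (mu_eq hκ1) (weighted_mu_sum_lt_one hκ1 hT) rfl hδ1
  have hsum := (h x hx).2 θ hθ (1 - mu d n κ ε / (1 - 2 * mu d n κ ε)) (by linarith)
  rw [criterion]
  refine mul_nonpos_of_nonneg_of_nonpos (inv_nonneg.2 hl.le)
    (mul_nonpos_of_nonneg_of_nonpos (by positivity) ?_)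
  simp only [one_mul] at hsum
  refine hsum.le.trans (mul_nonpos_of_nonneg_of_nonpos (by positivity) ?_)
  refine le_trans (le_of_eq ?_) hdrift
  ring

end

end RobustGram

theorem proposition1p2p3 :
    -- the deviation bounds
    (∀ {Ω : Type*} [MeasurableSpace Ω] (Pr : Measure Ω) [IsProbabilityMeasure Pr]
      (d n : ℕ) (P : Measure (EuclideanSpace ℝ (Fin d))) [IsProbabilityMeasure P]
      (X : Fin n → Ω → EuclideanSpace ℝ (Fin d)) (κ ε : ℝ),
      (∀ i, HasLaw (X i) P Pr) → iIndepFun X Pr →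
      Integrable (fun x => ‖x‖ ^ 2) P →
      1 < κ → RobustGram.kurtosis P ≤ ENNReal.ofReal κ →
      0 < ε → RobustGram.threshold d κ ε < n →
      RobustGram.ProbAtLeast Pr (1 - 2 * ε)
        {ω | ∀ θ : EuclideanSpace ℝ (Fin d),
          (RobustGram.relError P (RobustGram.scale d n κ ε) (fun i => X i ω) θ).abs ≤
            ENNReal.ofReal (RobustGram.mu d n κ ε / (1 - 2 * RobustGram.mu d n κ ε))} ∧
      RobustGram.ProbAtLeast Pr (1 - ε)
        {ω | ∀ θ : EuclideanSpace ℝ (Fin d),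
          RobustGram.relError P (RobustGram.scale d n κ ε) (fun i => X i ω) θ ≤
            ((RobustGram.mu d n κ ε / (1 - 2 * RobustGram.mu d n κ ε) : ℝ) : EReal)} ∧
      RobustGram.ProbAtLeast Pr (1 - ε)
        {ω | ∀ θ : EuclideanSpace ℝ (Fin d),
          ((-(RobustGram.mu d n κ ε / (1 - 2 * RobustGram.mu d n κ ε)) : ℝ) : EReal) ≤
            RobustGram.relError P (RobustGram.scale d n κ ε) (fun i => X i ω) θ}) ∧
    -- the order of magnitude of the error bound, with a numerical constant
    (∃ C : ℝ, 0 < C ∧ ∀ (d n : ℕ) (κ ε : ℝ), 1 < κ → 0 < ε →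
      0 ≤ Real.log ε⁻¹ + 0.73 * d → RobustGram.threshold d κ ε < n →
      RobustGram.mu d n κ ε < 1 / 2 ∧
      RobustGram.mu d n κ ε / (1 - 2 * RobustGram.mu d n κ ε) ≤
        C * √(κ * (d + Real.log ε⁻¹) / n)) ∧
    -- the order of magnitude of the threshold, for `κ` bounded away from `1`
    (∀ κ₀ : ℝ, 1 < κ₀ → ∃ C : ℝ, 0 < C ∧ ∀ (d : ℕ) (κ ε : ℝ), κ₀ ≤ κ → 0 < ε →
      0 ≤ Real.log ε⁻¹ + 0.73 * d →
      RobustGram.threshold d κ ε ≤ C * (κ * (d + Real.log ε⁻¹))) := by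
  refine ⟨?_, ⟨1000, by norm_num, fun d n κ ε hκ _ hL hT => ?_⟩, fun κ₀ hκ₀ => ?_⟩
  · intro Ω _ Pr _ d n P _ X κ ε hX hind hP hκ1 hκ hε hT
    have hle := RobustGram.probAtLeast_relError_le hX hind hP hκ1 hκ hε hT
    have hge := RobustGram.probAtLeast_neg_le_relError hX hind hP hκ1 hκ hε hT
    refine ⟨?_, hle, hge⟩
    obtain ⟨B, hB, hBsub, hBp⟩ := hge.inter hle
    refine ⟨B, hB, fun ω hω θ => ?_, by rwa [two_mul]⟩
    exact RobustGram.abs_le_ofReal ((hBsub hω).1 θ) ((hBsub hω).2 θ)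
  · have := RobustGram.one_sub_two_mul_mu_ge hκ hT
    exact ⟨by linarith, RobustGram.mu_div_le hκ hL hT⟩
  · have hκ₀' : 0 < κ₀ - 1 := by linarith
    exact ⟨_, by positivity, fun d κ ε hκ _ hL => RobustGram.threshold_le hκ₀ hκ hL⟩
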